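/- Consider a finite directed graph $G=(V,A)$ (parallel arcs allowed) with terminals $s,t\in V$ that is two-terminal series-parallel with source $s$ and sink $t$, i.e. it is built from single arcs (with two distinct end nodes) by series and parallel compositions. Let $\mathcal{X}\subseteq\{0,1\}^{A}$ be the set of characteristic vectors of the simple directed $s$-$t$ paths of $G$. Let $C\in\mathbb{Q}_{\ge 0}^{A}$ be the first-stage costs, let $c_1,\dots,c_K\in\mathbb{Q}_{\ge 0}^{A}$ be the second-stage cost scenarios, and let $p_1,\dots,p_K\in\mathbb{Q}_{\ge 0}$ with $\sum_{j} p_j=1$ be their probabilities. Put $\Pr_{\min}=\min\{p_j : p_j>0\}$. Define $$\mathcal{X}'=\{x\in\{0,1\}^{A} : \exists\, y\in\{0,1\}^{A},\ x+y\in\mathcal{X}\},\qquad \mathcal{R}_x=\{y\in\{0,1\}^{A} : x+y\in\mathcal{X}\}\quad (x\in\mathcal{X}').$$ For $\alpha\in[0,1)$ the problem TSt-CVaR$_\alpha$ Shortest Path (with set $\mathcal{X}$) asks for $x\in\mathcal{X}'$ minimizing $$F_\alpha(x)=\mathbf{CVaR}_\alpha[Y_x],\qquad \mathbf{CVaR}_\alpha[Y]=\inf_{\gamma\in\mathbb{R}}\Bigl(\gamma+\tfrac{1}{1-\alpha}\,\mathbf{E}\bigl[\max(Y-\gamma,0)\bigr]\Bigr),$$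 where $Y_x$ is the random variable that takes the value $C^{T}x+\min_{y\in\mathcal{R}_x}c_j^{T}y$ with probability $p_j$, $j=1,\dots,K$. Then TSt-CVaR$_\alpha$ Shortest Path with set $\mathcal{X}$ on series-parallel graphs is approximable within $\min\{1/\Pr_{\min},\,1/(1-\alpha)\}$ for every $\alpha\in[0,1)$. Precisely: there is an algorithm which, on input $(G,s,t,C,(c_j)_j,(p_j)_j)$ with all numbers written in binary, runs in time polynomial in the length of the input and outputs a vector $x\in\mathcal{X}'$ such that, for every real $\alpha\in[0,1)$, $$F_\alpha(x)\le \min\Bigl\{\frac{1}{\Pr_{\min}},\frac{1}{1-\alpha}\Bigr\}\cdot\min_{x'\in\mathcal{X}'}F_\alpha(x').$$ -/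

import Mathlib

/-!
Two-stage shortest path problems with the CVaR criterion on series-parallel networks, and
polynomial-time approximation algorithms.
-/

namespace TwoStage

section Machine

/-- Finite data: binary trees whose leaves are natural numbers (written in binary). -/
inductive Data : Type
  | num (n : ℕ) : Data
  | pair (a b : Data) : Data

/-- Length of a datum in bits: numbers are charged their binary length, and every node of the tree
is charged one further unit. -/
def Data.size : Data → ℕ
  | .num n => Nat.size n + 1
  | .pair a b => a.size + b.size + 1

/-- First component (`0` for a number). -/
def Data.left : Data → Data
  | .num _ => .num 0
  | .pair a _ => a

/-- Second component (`0` for a number). -/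
def Data.right : Data → Data
  | .num _ => .num 0
  | .pair _ b => b

/-- `1` for a pair, `0` for a number. -/
def Data.tag : Data → Data
  | .num _ => .num 0
  | .pair _ _ => .num 1

/-- A binary operation on natural numbers, applied to a pair of numbers (`0` on other data). -/
def Data.arith (op : ℕ → ℕ → ℕ) : Data → Data
  | .pair (.num a) (.num b) => .num (op a b)
  | _ => .num 0

/-- Programs of a while-language over `Data`. A program transforms one datum into another one.
The primitives are constants, projections, a test for the shape of a datum, and integer arithmetic
(`sub` is truncated subtraction and `div` integer division); programs are combined by pairing,
sequencing `seq f g` (first `f`, then `g`), branching, and `loop c f` (while the test `c` succeeds,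
apply `f`). -/
inductive Prog : Type
  | skip : Prog
  | const (n : ℕ) : Prog
  | left : Prog
  | right : Prog
  | isPair : Prog
  | add : Prog
  | sub : Prog
  | mul : Prog
  | div : Prog
  | pair (f g : Prog) : Prog
  | seq (f g : Prog) : Prog
  | cond (c f g : Prog) : Prog
  | loop (c f : Prog) : Prog

/-- `Run P x y k`: on input `x` the program `P` halts with output `y`, at total cost `k`.
Logarithmic cost criterion: executing any construct of the language is charged the bit length of
the whole datum it is applied to, in addition to the costs of its parts. A test fails exactly if
its value is the number `0`. -/
inductive Run : Prog → Data → Data → ℕ → Prop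
  | skip (x : Data) : Run .skip x x x.size
  | const (n : ℕ) (x : Data) : Run (.const n) x (.num n) x.size
  | left (x : Data) : Run .left x x.left x.size
  | right (x : Data) : Run .right x x.right x.size
  | isPair (x : Data) : Run .isPair x x.tag x.size
  | add (x : Data) : Run .add x (x.arith (fun a b => a + b)) x.size
  | sub (x : Data) : Run .sub x (x.arith (fun a b => a - b)) x.size
  | mul (x : Data) : Run .mul x (x.arith (fun a b => a * b)) x.size
  | div (x : Data) : Run .div x (x.arith (fun a b => a / b)) x.size
  | pair {f g : Prog} {x y z : Data} {k l : ℕ} (hf : Run f x y k) (hg : Run g x z l) :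
      Run (.pair f g) x (.pair y z) (k + l + x.size)
  | seq {f g : Prog} {x y z : Data} {k l : ℕ} (hf : Run f x y k) (hg : Run g y z l) :
      Run (.seq f g) x z (k + l + x.size)
  | condTrue {c f g : Prog} {x v y : Data} {k l : ℕ} (hc : Run c x v k) (hv : v ≠ .num 0)
      (hf : Run f x y l) : Run (.cond c f g) x y (k + l + x.size)
  | condFalse {c f g : Prog} {x y : Data} {k l : ℕ} (hc : Run c x (.num 0) k)
      (hg : Run g x y l) : Run (.cond c f g) x y (k + l + x.size)
  | loopDone {c f : Prog} {x : Data} {k : ℕ} (hc : Run c x (.num 0) k) :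
      Run (.loop c f) x x (k + x.size)
  | loopStep {c f : Prog} {x v y z : Data} {k l r : ℕ} (hc : Run c x v k) (hv : v ≠ .num 0)
      (hf : Run f x y l) (hw : Run (.loop c f) y z r) :
      Run (.loop c f) x z (k + l + r + x.size)

/-- Programs are deterministic: output and cost are determined by the input. -/
theorem Run.unique {P : Prog} {x y : Data} {k : ℕ} (h : Run P x y k) :
    ∀ {y' : Data} {k' : ℕ}, Run P x y' k' → y = y' ∧ k = k' := by
  induction h with
  | pair _ _ ihf ihg =>
    intro y' k' h'
    cases h' with
    | pair hf hg =>
      obtain ⟨rfl, rfl⟩ := ihf hf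
      obtain ⟨rfl, rfl⟩ := ihg hg
      exact ⟨rfl, rfl⟩
  | seq _ _ ihf ihg =>
    intro y' k' h'
    cases h' with
    | seq hf hg =>
      obtain ⟨rfl, rfl⟩ := ihf hf
      obtain ⟨rfl, rfl⟩ := ihg hg
      exact ⟨rfl, rfl⟩
  | condTrue _ hv _ ihc ihf =>
    intro y' k' h'
    cases h' with
    | condTrue hc _ hf =>
      obtain ⟨rfl, rfl⟩ := ihc hc
      obtain ⟨rfl, rfl⟩ := ihf hf
      exact ⟨rfl, rfl⟩
    | condFalse hc _ => exact absurd (ihc hc).1 hv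
  | condFalse _ _ ihc ihg =>
    intro y' k' h'
    cases h' with
    | condTrue hc hv _ => exact absurd (ihc hc).1.symm hv
    | condFalse hc hg =>
      obtain ⟨_, rfl⟩ := ihc hc
      obtain ⟨rfl, rfl⟩ := ihg hg
      exact ⟨rfl, rfl⟩
  | loopDone _ ihc =>
    intro y' k' h'
    cases h' with
    | loopDone hc =>
      obtain ⟨_, rfl⟩ := ihc hc
      exact ⟨rfl, rfl⟩
    | loopStep hc hv _ _ => exact absurd (ihc hc).1.symm hv
  | loopStep _ hv _ _ ihc ihf ihw =>
    intro y' k' h'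
    cases h' with
    | loopDone hc => exact absurd (ihc hc).1 hv
    | loopStep hc _ hf hw =>
      obtain ⟨rfl, rfl⟩ := ihc hc
      obtain ⟨rfl, rfl⟩ := ihf hf
      obtain ⟨rfl, rfl⟩ := ihw hw
      exact ⟨rfl, rfl⟩
  | _ => intro y' k' h'; cases h'; exact ⟨rfl, rfl⟩

/-- A list as a datum: `0` for the empty list, and a pair of head and tail otherwise. -/
def encodeList : List Data → Data
  | [] => .num 0
  | x :: l => .pair x (encodeList l)

/-- A finite sequence of data as a datum. -/
def encodeFn {k : ℕ} (f : Fin k → Data) : Data := encodeList (List.ofFn f)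

/-- A nonnegative rational as the pair of its numerator and denominator in lowest terms. -/
def encodeRat (q : NNRat) : Data := .pair (.num q.num) (.num q.den)

end Machine

section Approximation

/-- A minimization problem: instances, the solutions considered for an instance, which of them are
feasible, their costs, and the way in which instances and solutions are written down. -/
structure MinProblem where
  Inst : Type
  Sol : Inst → Type
  feasible : (I : Inst) → Set (Sol I)
  cost : (I : Inst) → Sol I → ℝ
  encodeInst : Inst → Data
  encodeSol : (I : Inst) → Sol I → Data

/-- The optimal value of an instance. -/
noncomputable def MinProblem.opt (P : MinProblem) (I : P.Inst) : ℝ :=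
  sInf (P.cost I '' P.feasible I)

/-- The program `A` is a polynomial-time approximation algorithm for `P` with performance ratio `ρ`:
on every instance it halts within a number of steps that is polynomial in the length of the
instance, and outputs a feasible solution of cost at most `ρ` times the optimal value. -/
def IsApproxAlgorithm (A : Prog) (P : MinProblem) (ρ : P.Inst → ℝ) : Prop :=
  ∃ q : Polynomial ℕ, ∀ I : P.Inst, ∃ x ∈ P.feasible I, ∃ k : ℕ,
    Run A (P.encodeInst I) (P.encodeSol I x) k ∧
    k ≤ q.eval (P.encodeInst I).size ∧
    P.cost I x ≤ ρ I * P.opt I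

end Approximation

section TwoStageProblem

/-- Costs of a two-stage problem over `m` elements: the first-stage costs `C`, and `K` second-stage
cost scenarios `c j` which occur with probabilities `p j`. -/
structure Costs (m : ℕ) where
  K : ℕ
  C : Fin m → NNRat
  c : Fin K → Fin m → NNRat
  p : Fin K → NNRat
  sum_p : ∑ j, p j = 1

/-- The smallest (positive) probability of a scenario. -/
noncomputable def Costs.prMin {m : ℕ} (D : Costs m) : ℝ :=
  ⨅ j : {j : Fin D.K // 0 < D.p j}, (D.p j : ℝ)

/-- Zero-one vectors. -/
def IsBinary {m : ℕ} (x : Fin m → ℕ) : Prop := ∀ a, x a = 0 ∨ x a = 1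

/-- `R_x`: the recourse actions which complete the partial solution `x` to a solution in `X`. -/
def recourse {m : ℕ} (X : Set (Fin m → ℕ)) (x : Fin m → ℕ) : Set (Fin m → ℕ) :=
  {y | IsBinary y ∧ x + y ∈ X}

/-- `X'`: the partial solutions which can be chosen in the first stage. -/
def partialSolutions {m : ℕ} (X : Set (Fin m → ℕ)) : Set (Fin m → ℕ) :=
  {x | IsBinary x ∧ (recourse X x).Nonempty}

/-- The linear cost `cᵀ x`. -/
noncomputable def linCost {m : ℕ} (c : Fin m → NNRat) (x : Fin m → ℕ) : ℝ :=
  ∑ a, (c a : ℝ) * (x a : ℝ)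

/-- The cost of an optimal recourse action for `x` under the scenario `c`. -/
noncomputable def recourseCost {m : ℕ} (X : Set (Fin m → ℕ)) (x : Fin m → ℕ) (c : Fin m → NNRat) :
    ℝ :=
  sInf (linCost c '' recourse X x)

/-- Conditional value at risk, at level `α`, of the random variable that takes the value `Y j`
with probability `p j`: `inf_γ (γ + E[(Y - γ)⁺] / (1 - α))`. -/
noncomputable def cvar {K : ℕ} (α : ℝ) (p Y : Fin K → ℝ) : ℝ :=
  ⨅ γ : ℝ, (γ + 1 / (1 - α) * ∑ j, p j * max (Y j - γ) 0)

/-- The CVaR of the total (first plus second stage) cost of the first-stage solution `x`. -/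
noncomputable def Costs.cvarCost {m : ℕ} (D : Costs m) (X : Set (Fin m → ℕ)) (α : ℝ)
    (x : Fin m → ℕ) : ℝ :=
  cvar α (fun j => (D.p j : ℝ)) (fun j => linCost D.C x + recourseCost X x (D.c j))

end TwoStageProblem

section ShortestPath

/-- A directed graph with source `s` and target `t`; parallel arcs are allowed. -/
structure Network where
  n : ℕ
  m : ℕ
  tail : Fin m → Fin n
  head : Fin m → Fin n
  s : Fin n
  t : Fin n

namespace Network

/-- The list `l` of arcs is a directed walk from `u` to `w`. -/
def IsWalk (G : Network) : Fin G.n → List (Fin G.m) → Fin G.n → Prop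
  | u, [], w => u = w
  | u, a :: l, w => G.tail a = u ∧ G.IsWalk (G.head a) l w

/-- The list `l` of arcs is a simple path from `s` to `t`: no node is visited twice. -/
def IsSimplePath (G : Network) (l : List (Fin G.m)) : Prop :=
  G.IsWalk G.s l G.t ∧ (G.s :: l.map G.head).Nodup

/-- The set `X` of characteristic vectors of the simple `s`-`t` paths. -/
def pathVectors (G : Network) : Set (Fin G.m → ℕ) :=
  {x | ∃ l, G.IsSimplePath l ∧ ∀ a, x a = if a ∈ l then 1 else 0}

/-- The nodes which are incident with an arc of `E`. -/
def nodes (G : Network) (E : Finset (Fin G.m)) : Set (Fin G.n) :=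
  {v | ∃ a ∈ E, G.tail a = v ∨ G.head a = v}

/-- The arcs in `E`, with the nodes incident with them, form a two-terminal series-parallel graph
with source `u` and sink `w`. -/
inductive SP (G : Network) : Finset (Fin G.m) → Fin G.n → Fin G.n → Prop
  | arc (a : Fin G.m) (h : G.tail a ≠ G.head a) : SP G {a} (G.tail a) (G.head a)
  | series {E F : Finset (Fin G.m)} {u v w : Fin G.n} (hE : SP G E u v) (hF : SP G F v w)
      (h : G.nodes E ∩ G.nodes F = {v}) : SP G (E ∪ F) u w
  | parallel {E F : Finset (Fin G.m)} {u w : Fin G.n} (hE : SP G E u w) (hF : SP G F u w)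
      (hd : Disjoint E F) (h : G.nodes E ∩ G.nodes F = {u, w}) : SP G (E ∪ F) u w

/-- `G` is a two-terminal series-parallel graph with source `s` and sink `t`. -/
def IsSeriesParallel (G : Network) : Prop :=
  G.SP Finset.univ G.s G.t ∧ G.nodes Finset.univ = Set.univ

end Network

/-- An instance of the two-stage shortest path problem on series-parallel graphs. -/
structure SPInstance where
  G : Network
  isSP : G.IsSeriesParallel
  D : Costs G.m

/-- An instance is written down as the number of nodes, the two terminals, the list of arcs, the
first-stage costs, the scenarios and their probabilities; all numbers in binary. -/
def SPInstance.encode (I : SPInstance) : Data :=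
  encodeList
    [.num I.G.n, .num I.G.s, .num I.G.t,
     encodeFn (fun a => .pair (.num (I.G.tail a)) (.num (I.G.head a))),
     encodeFn (fun a => encodeRat (I.D.C a)),
     encodeFn (fun j => encodeFn (fun a => encodeRat (I.D.c j a))),
     encodeFn (fun j => encodeRat (I.D.p j))]

/-- The problem `TSt-CVaR_α Shortest Path` with the set `X` of simple paths, on series-parallel
graphs. -/
noncomputable def cvarShortestPathSP (α : ℝ) : MinProblem where
  Inst := SPInstance
  Sol I := Fin I.G.m → ℕ
  feasible I := partialSolutions I.G.pathVectors
  cost I x := I.D.cvarCost I.G.pathVectors α x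
  encodeInst I := I.encode
  encodeSol _ x := encodeFn (fun a => .num (x a))

end ShortestPath

end TwoStage

/-!
The first-stage solution which the algorithm outputs minimizes the *expected* cost. Such a solution
is good for every level `α` at once: the expectation is a lower bound on the CVaR, while for
nonnegative costs the CVaR is at most `1 / (1 - α)` times the expectation (take the level `0` in the
infimum) and at most the largest value of positive probability, hence at most `1 / Pr_min` times the
expectation (`cvar_le_mul_expectation`, `Costs.cvarCost_le`).

The expected cost can be minimized exactly because series-parallel graphs are acyclic: a potential
with the values `0` and `1` at the two terminals is built along the decomposition
(`SP.exists_potential`). In an acyclic network all `s`-`t` walks are simple paths, and the arcs of a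
first-stage solution `x` occur in the same order in all paths which contain them
(`exists_common_sublist`). So `x` together with optimal recourse actions is a walk from `s` to `t` in
an auxiliary graph with two kinds of edges: the arcs of the network at their first-stage costs, and,
for nodes `u` and `w`, a recourse edge whose cost is the expected distance from `u` to `w` in the
second stage. Conversely, each walk in this graph yields a first-stage solution whose expected cost
is at most the cost of the walk (`auxiliary_sound`, `auxiliary_complete`). The algorithm therefore needs only
shortest walks, which the Bellman–Ford algorithm finds, first for each scenario and then in the
auxiliary graph; the decomposition of the network need not be known. All costs are made integral by
multiplying with the square of a common denominator of all numbers of the instance.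

That this is a polynomial-time algorithm is shown without writing down a program: the class
`PolyTime` of functions between encoded types which some program computes in polynomial time is
closed under composition, pairing, arithmetic, branching, and iteration over a list with
polynomially bounded intermediate states (`PolyTime.foldl`).
-/

namespace TwoStage

/-! ### Polynomial-time computable functions -/

/-- An encoding of the elements of a type as data. It need not be injective. -/
class Enc (α : Type) where
  enc : α → Data

open Enc

instance : Enc ℕ := ⟨.num⟩
instance : Enc Unit := ⟨fun _ => .num 0⟩
instance {α β : Type} [Enc α] [Enc β] : Enc (α × β) := ⟨fun x => .pair (enc x.1) (enc x.2)⟩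
instance {α : Type} [Enc α] : Enc (List α) := ⟨fun l => encodeList (l.map enc)⟩

/-- The length of the encoding. -/
def esize {α : Type} [Enc α] (a : α) : ℕ := (enc a).size

variable {α β γ σ : Type} [Enc α] [Enc β] [Enc γ] [Enc σ]

@[simp] theorem esize_nat (n : ℕ) : esize n = Nat.size n + 1 := rfl
@[simp] theorem esize_prod (x : α × β) : esize x = esize x.1 + esize x.2 + 1 := rfl
@[simp] theorem esize_nil : esize ([] : List α) = 1 := rfl
@[simp] theorem esize_cons (x : α) (l : List α) : esize (x :: l) = esize x + esize l + 1 := rfl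

theorem Data.one_le_size (d : Data) : 1 ≤ d.size := by
  cases d <;> simp [Data.size]

theorem length_le_esize (l : List α) : l.length ≤ esize l := by
  induction l with
  | nil => simp
  | cons x l ih => simp; omega

theorem esize_le_of_mem {x : α} {l : List α} (h : x ∈ l) : esize x ≤ esize l := by
  induction l with
  | nil => simp at h
  | cons y l ih =>
    rcases List.mem_cons.1 h with rfl | h
    · simp; omega
    · have := ih h; simp; omega

theorem esize_append (l l' : List α) : esize (l ++ l') + 1 = esize l + esize l' := by
  induction l with
  | nil => simp; omega
  | cons x l ih => simp; omega

theorem esize_reverse (l : List α) : esize l.reverse = esize l := by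
  induction l with
  | nil => rfl
  | cons x l ih =>
    have := esize_append l.reverse [x]
    simp at this ⊢; omega

theorem esize_le_of_sublist {l l' : List α} (h : l.Sublist l') : esize l ≤ esize l' := by
  induction h with
  | slnil => simp
  | cons x _ ih => simp; omega
  | cons_cons x _ ih => simp; omega

theorem esize_list_le {l : List α} {B : ℕ} (h : ∀ x ∈ l, esize x ≤ B) :
    esize l ≤ l.length * (B + 1) + 1 := by
  induction l with
  | nil => simp
  | cons x l ih =>
    have h1 := ih fun y hy => h y (List.mem_cons_of_mem _ hy)
    have h2 := h x List.mem_cons_self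
    simp only [esize_cons, List.length_cons, add_mul, one_mul]; omega

theorem natSize_add_le (a b : ℕ) : Nat.size (a + b) ≤ Nat.size a + Nat.size b := by
  rcases Nat.eq_zero_or_pos a with rfl | ha
  · simp
  rcases Nat.eq_zero_or_pos b with rfl | hb
  · simp
  rw [Nat.size_le, pow_add]
  have h1 : a + 1 ≤ 2 ^ Nat.size a := Nat.lt_size_self a
  have h2 : b + 1 ≤ 2 ^ Nat.size b := Nat.lt_size_self b
  nlinarith

theorem natSize_mul_le (a b : ℕ) : Nat.size (a * b) ≤ Nat.size a + Nat.size b := by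
  rw [Nat.size_le, pow_add]
  have h1 := Nat.lt_size_self a
  have h2 := Nat.lt_size_self b
  exact Nat.mul_lt_mul'' h1 h2

/-- The total length of the constants of a program. -/
def Prog.constSize : Prog → ℕ
  | .const n => Nat.size n + 1
  | .pair f g => f.constSize + g.constSize
  | .seq f g => f.constSize + g.constSize
  | .cond _ f g => f.constSize + g.constSize
  | .loop _ f => f.constSize
  | _ => 0

theorem Data.size_arith_le {op : ℕ → ℕ → ℕ} (h : ∀ a b, Nat.size (op a b) ≤ Nat.size a + Nat.size b)
    (x : Data) : (x.arith op).size ≤ x.size := by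
  unfold Data.arith
  split
  · rename_i a b; have := h a b; simp [Data.size]; omega
  · simpa [Data.size] using x.one_le_size

/-- The output of a run is, up to the constants of the program, at most as long as its cost. -/
theorem Run.size_le {P : Prog} {x y : Data} {k : ℕ} (h : Run P x y k) :
    y.size ≤ k + P.constSize := by
  have hl : ∀ x : Data, x.left.size ≤ x.size := fun x => by
    cases x <;> simp [Data.left, Data.size]; omega
  have hr : ∀ x : Data, x.right.size ≤ x.size := fun x => by
    cases x <;> simp [Data.right, Data.size]; omega
  have ht : ∀ x : Data, x.tag.size ≤ x.size := fun x => by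
    cases x with
    | num => simp [Data.tag, Data.size]
    | pair a b => have := a.one_le_size; simp [Data.tag, Data.size]; omega
  induction h with
  | skip x => simp
  | const n x => simp [Prog.constSize, Data.size]
  | left x => exact (hl x).trans (by simp)
  | right x => exact (hr x).trans (by simp)
  | isPair x => exact (ht x).trans (by simp)
  | add x => exact (x.size_arith_le natSize_add_le).trans (by simp)
  | sub x =>
    exact (x.size_arith_le fun a b => (Nat.size_le_size (Nat.sub_le a b)).trans (by simp)).trans
      (by simp)
  | mul x => exact (x.size_arith_le natSize_mul_le).trans (by simp)
  | div x =>
    exact (x.size_arith_le fun a b => (Nat.size_le_size (Nat.div_le_self a b)).trans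
      (by simp)).trans (by simp)
  | @pair f g x y z k l _ _ h1 h2 =>
    have := x.one_le_size; simp only [Data.size, Prog.constSize]; omega
  | seq _ _ h1 h2 => simp only [Prog.constSize]; omega
  | condTrue _ _ _ h1 h2 => simp only [Prog.constSize]; omega
  | condFalse _ _ h1 h2 => simp only [Prog.constSize]; omega
  | loopDone _ => omega
  | loopStep _ _ _ _ h1 h2 h3 => simp only [Prog.constSize] at *; omega

/-- `g` is bounded by a polynomial in the length of the encoding of its argument. -/
def PolyBdd (g : α → ℕ) : Prop := ∃ q : Polynomial ℕ, ∀ a, g a ≤ q.eval (esize a)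

/-- `f` is computed by some program in polynomial time. -/
def PolyTime (f : α → β) : Prop :=
  ∃ P : Prog, ∃ q : Polynomial ℕ, ∀ a, ∃ k, Run P (enc a) (enc (f a)) k ∧ k ≤ q.eval (esize a)

theorem eval_le_eval (q : Polynomial ℕ) {m n : ℕ} (h : m ≤ n) :
    q.eval m ≤ q.eval n := by
  rw [Polynomial.eval_eq_sum, Polynomial.eval_eq_sum]
  exact Finset.sum_le_sum fun i _ => Nat.mul_le_mul_left _ (Nat.pow_le_pow_left h i)

namespace PolyBdd

theorem mono {g h : α → ℕ} (hh : PolyBdd h) (hgh : ∀ a, g a ≤ h a) : PolyBdd g :=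
  let ⟨q, hq⟩ := hh
  ⟨q, fun a => (hgh a).trans (hq a)⟩

theorem const (n : ℕ) : PolyBdd fun _ : α => n := ⟨Polynomial.C n, fun a => by simp⟩

theorem size : PolyBdd fun a : α => esize a := ⟨Polynomial.X, fun a => by simp⟩

theorem add {g h : α → ℕ} (hg : PolyBdd g) (hh : PolyBdd h) : PolyBdd fun a => g a + h a :=
  let ⟨p, hp⟩ := hg
  let ⟨q, hq⟩ := hh
  ⟨p + q, fun a => by simpa using add_le_add (hp a) (hq a)⟩

theorem mul {g h : α → ℕ} (hg : PolyBdd g) (hh : PolyBdd h) : PolyBdd fun a => g a * h a :=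
  let ⟨p, hp⟩ := hg
  let ⟨q, hq⟩ := hh
  ⟨p * q, fun a => by simpa using Nat.mul_le_mul (hp a) (hq a)⟩

theorem eval {g : α → ℕ} (hg : PolyBdd g) (p : Polynomial ℕ) : PolyBdd fun a => p.eval (g a) :=
  let ⟨q, hq⟩ := hg
  ⟨p.comp q, fun a => by
    simpa [Polynomial.eval_comp] using eval_le_eval p (hq a)⟩

end PolyBdd

/-- It suffices to bound the cost of a program by any polynomially bounded function. -/
theorem PolyTime.of_run {f : α → β} (P : Prog) {g : α → ℕ} (hg : PolyBdd g)
    (h : ∀ a, ∃ k, Run P (enc a) (enc (f a)) k ∧ k ≤ g a) : PolyTime f :=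
  let ⟨q, hq⟩ := hg
  ⟨P, q, fun a => let ⟨k, hk, hka⟩ := h a; ⟨k, hk, hka.trans (hq a)⟩⟩

theorem PolyTime.polyBdd {f : α → β} (hf : PolyTime f) : PolyBdd fun a => esize (f a) := by
  obtain ⟨P, q, h⟩ := hf
  refine ((PolyBdd.size.eval q).add (PolyBdd.const P.constSize)).mono fun a => ?_
  obtain ⟨k, hk, hka⟩ := h a
  exact hk.size_le.trans (by simpa using hka)

theorem PolyBdd.comp {g : β → ℕ} {f : α → β} (hg : PolyBdd g) (hf : PolyTime f) :
    PolyBdd fun a => g (f a) :=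
  let ⟨q, hq⟩ := hg
  (hf.polyBdd.eval q).mono fun a => hq (f a)

namespace PolyTime

theorem id : PolyTime fun a : α => a :=
  of_run .skip PolyBdd.size fun _ => ⟨_, .skip _, le_rfl⟩

theorem comp {g : β → γ} {f : α → β} (hg : PolyTime g) (hf : PolyTime f) :
    PolyTime fun a => g (f a) := by
  have hf' := hf
  obtain ⟨P, p, hp⟩ := hf'
  obtain ⟨Q, q, hq⟩ := hg
  refine of_run (.seq P Q) (((PolyBdd.size.eval p).add (hf.polyBdd.eval q)).add PolyBdd.size)
    fun a => ?_
  obtain ⟨k, hk, hka⟩ := hp a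
  obtain ⟨l, hl, hla⟩ := hq (f a)
  exact ⟨_, .seq hk hl, by gcongr; exact le_rfl⟩

theorem pair {f : α → β} {g : α → γ} (hf : PolyTime f) (hg : PolyTime g) :
    PolyTime fun a => (f a, g a) := by
  obtain ⟨P, p, hp⟩ := hf
  obtain ⟨Q, q, hq⟩ := hg
  refine of_run (.pair P Q) (((PolyBdd.size.eval p).add (PolyBdd.size.eval q)).add PolyBdd.size)
    fun a => ?_
  obtain ⟨k, hk, hka⟩ := hp a
  obtain ⟨l, hl, hla⟩ := hq a
  exact ⟨_, .pair hk hl, by gcongr; exact le_rfl⟩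

theorem fst {f : α → β × γ} (hf : PolyTime f) : PolyTime fun a => (f a).1 :=
  comp (g := Prod.fst) (of_run .left PolyBdd.size fun _ => ⟨_, .left _, le_rfl⟩) hf

theorem snd {f : α → β × γ} (hf : PolyTime f) : PolyTime fun a => (f a).2 :=
  comp (g := Prod.snd) (of_run .right PolyBdd.size fun _ => ⟨_, .right _, le_rfl⟩) hf

theorem nat (n : ℕ) : PolyTime fun _ : α => n :=
  of_run (.const n) PolyBdd.size fun _ => ⟨_, .const _ _, le_rfl⟩

theorem add {f g : α → ℕ} (hf : PolyTime f) (hg : PolyTime g) : PolyTime fun a => f a + g a :=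
  comp (g := fun x : ℕ × ℕ => x.1 + x.2)
    (of_run .add PolyBdd.size fun _ => ⟨_, .add _, le_rfl⟩) (hf.pair hg)

theorem sub {f g : α → ℕ} (hf : PolyTime f) (hg : PolyTime g) : PolyTime fun a => f a - g a :=
  comp (g := fun x : ℕ × ℕ => x.1 - x.2)
    (of_run .sub PolyBdd.size fun _ => ⟨_, .sub _, le_rfl⟩) (hf.pair hg)

theorem mul {f g : α → ℕ} (hf : PolyTime f) (hg : PolyTime g) : PolyTime fun a => f a * g a :=
  comp (g := fun x : ℕ × ℕ => x.1 * x.2)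
    (of_run .mul PolyBdd.size fun _ => ⟨_, .mul _, le_rfl⟩) (hf.pair hg)

theorem div {f g : α → ℕ} (hf : PolyTime f) (hg : PolyTime g) : PolyTime fun a => f a / g a :=
  comp (g := fun x : ℕ × ℕ => x.1 / x.2)
    (of_run .div PolyBdd.size fun _ => ⟨_, .div _, le_rfl⟩) (hf.pair hg)

/-- Branching on whether a polynomial-time computable number vanishes. -/
theorem ite_zero {c : α → ℕ} {f g : α → β} (hc : PolyTime c) (hf : PolyTime f) (hg : PolyTime g) :
    PolyTime fun a => if c a = 0 then f a else g a := by
  obtain ⟨R, r, hr⟩ := hc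
  obtain ⟨P, p, hp⟩ := hf
  obtain ⟨Q, q, hq⟩ := hg
  refine of_run (.cond R Q P) (((PolyBdd.size.eval r).add
    ((PolyBdd.size.eval p).add (PolyBdd.size.eval q))).add PolyBdd.size) fun a => ?_
  obtain ⟨i, hi, hia⟩ := hr a
  obtain ⟨k, hk, hka⟩ := hp a
  obtain ⟨l, hl, hla⟩ := hq a
  by_cases h : c a = 0
  · rw [if_pos h]
    rw [h] at hi
    exact ⟨_, .condFalse hi hk, by simp only [esize] at *; omega⟩
  · rw [if_neg h]
    exact ⟨_, .condTrue hi (by simpa [enc] using h) hl, by simp only [esize] at *; omega⟩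

theorem ite_le {c d : α → ℕ} {f g : α → β} (hc : PolyTime c) (hd : PolyTime d) (hf : PolyTime f)
    (hg : PolyTime g) : PolyTime fun a => if c a ≤ d a then f a else g a := by
  simpa only [Nat.sub_eq_zero_iff_le] using (hc.sub hd).ite_zero hf hg

theorem ite_eq {c d : α → ℕ} {f g : α → β} (hc : PolyTime c) (hd : PolyTime d) (hf : PolyTime f)
    (hg : PolyTime g) : PolyTime fun a => if c a = d a then f a else g a := by
  have := ((hc.sub hd).add (hd.sub hc)).ite_zero hf hg
  convert this using 3
  omega

theorem nil : PolyTime fun _ : α => ([] : List β) :=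
  of_run (.const 0) PolyBdd.size fun _ => ⟨_, .const _ _, le_rfl⟩

theorem cons {f : α → β} {l : α → List β} (hf : PolyTime f) (hl : PolyTime l) :
    PolyTime fun a => f a :: l a :=
  comp (g := fun x : β × List β => x.1 :: x.2)
    (of_run .skip PolyBdd.size fun _ => ⟨_, .skip _, le_rfl⟩) (hf.pair hl)

theorem tail {l : α → List β} (hl : PolyTime l) : PolyTime fun a => (l a).tail :=
  comp (g := List.tail)
    (of_run .right PolyBdd.size fun l => ⟨_, by
      cases l <;> exact .right _, le_rfl⟩) hl

/-- `0` for the empty list and `1` otherwise. -/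
theorem isCons : PolyTime fun l : List α => if l.isEmpty then 0 else 1 :=
  of_run .isPair PolyBdd.size fun l => ⟨_, by cases l <;> exact .isPair _, le_rfl⟩

theorem ite_isEmpty {l : α → List γ} {f g : α → β} (hl : PolyTime l) (hf : PolyTime f)
    (hg : PolyTime g) : PolyTime fun a => if (l a).isEmpty then f a else g a := by
  have h : ∀ a, (if (l a).isEmpty then f a else g a) =
      if (if (l a).isEmpty then 0 else 1) = 0 then f a else g a := fun a => by
    cases l a <;> simp
  exact (funext h) ▸ (isCons.comp hl).ite_zero hf hg

/-- Bounded iteration: a loop over a list runs in polynomial time if one step does and the states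
which it passes through are polynomially bounded. -/
theorem foldl {f : α → σ → β → σ} {s : α → σ} {l : α → List β}
    (hf : PolyTime fun x : α × σ × β => f x.1 x.2.1 x.2.2) (hs : PolyTime s) (hl : PolyTime l)
    {B : α → ℕ} (hB : PolyBdd B)
    (h : ∀ a l', l' <+: l a → esize (l'.foldl (f a) (s a)) ≤ B a) :
    PolyTime fun a => (l a).foldl (f a) (s a) := by
  -- The state of the loop consists of the rest of the list, the argument, and the accumulator.
  -- A nonempty list is encoded like the pair of its head and its tail.
  have hstep : PolyTime fun x : (β × List β) × α × σ => (x.1.2, x.2.1, f x.2.1 x.2.2 x.1.1) :=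
    id.fst.snd.pair (id.snd.fst.pair
      (hf.comp (f := fun x : (β × List β) × α × σ => (x.2.1, x.2.2, x.1.1))
        (id.snd.fst.pair (id.snd.snd.pair id.fst.fst))))
  have htest : PolyTime fun x : List β × α × σ => if x.1.isEmpty then 0 else 1 :=
    isCons.comp id.fst
  obtain ⟨P, p, hp⟩ := hstep
  obtain ⟨T, t, ht⟩ := htest
  let Z : α → ℕ := fun a => esize (l a) + (esize a + B a + 1) + 1
  have hZ : PolyBdd Z :=
    (hl.polyBdd.add ((PolyBdd.size.add hB).add (PolyBdd.const 1))).add (PolyBdd.const 1)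
  have key : ∀ (a : α) (l' : List β) (s' : σ), esize l' ≤ esize (l a) →
      (∀ l'', l'' <+: l' → esize (l''.foldl (f a) s') ≤ B a) →
      ∃ k, Run (.loop T P) (enc (l', a, s')) (enc (([] : List β), a, l'.foldl (f a) s')) k ∧
        k ≤ (l'.length + 1) * (t.eval (Z a) + p.eval (Z a) + Z a) := by
    intro a l'
    induction l' with
    | nil =>
      intro s' h1 h2
      obtain ⟨k, hk, hka⟩ := ht ([], a, s')
      have hz : esize (([] : List β), a, s') ≤ Z a := by
        have := h2 [] List.prefix_rfl
        simp only [List.foldl_nil] at this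
        simp only [esize_prod, Z]; omega
      refine ⟨_, .loopDone hk, ?_⟩
      have := eval_le_eval t hz
      simp only [List.length_nil, zero_add, one_mul]
      change k + esize (([] : List β), a, s') ≤ _
      omega
    | cons x l' ih =>
      intro s' h1 h2
      obtain ⟨k, hk, hka⟩ := ht (x :: l', a, s')
      obtain ⟨k', hk', hka'⟩ := hp ((x, l'), a, s')
      obtain ⟨k'', hk'', hka''⟩ := ih (f a s' x) (by simp at h1; omega) fun l'' hl'' => by
        simpa using h2 (x :: l'') (List.cons_prefix_cons.2 ⟨rfl, hl''⟩)
      have hz : esize ((x :: l'), a, s') ≤ Z a := by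
        have := h2 [] List.nil_prefix
        simp only [List.foldl_nil] at this
        simp only [esize_prod, Z]; omega
      refine ⟨_, .loopStep hk (by simp [enc]) hk' hk'', ?_⟩
      have h3 := eval_le_eval t hz
      have h4 := eval_le_eval p hz
      simp only [List.length_cons]
      rw [add_mul (l'.length + 1) 1, one_mul]
      change k + k' + k'' + esize ((x :: l'), a, s') ≤ _
      change k' ≤ p.eval (esize (x :: l', a, s')) at hka'
      omega
  have hloop : PolyTime fun x : α => ((([] : List β), x, (l x).foldl (f x) (s x)) :
      List β × α × σ) := by
    obtain ⟨I, i, hi⟩ := hl.pair (id.pair hs)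
    refine of_run (.seq I (.loop T P)) (((PolyBdd.size.eval i).add
      ((hl.polyBdd.add (PolyBdd.const 1)).mul
        (((hZ.eval t).add (hZ.eval p)).add hZ))).add PolyBdd.size) fun a => ?_
    obtain ⟨k, hk, hka⟩ := hi a
    obtain ⟨k', hk', hka'⟩ := key a (l a) (s a) le_rfl (h a)
    refine ⟨_, .seq hk hk', ?_⟩
    have : (l a).length + 1 ≤ esize (l a) + 1 := by simpa using length_le_esize (l a)
    gcongr
    · exact hka'.trans (by gcongr)
    · exact le_rfl
  exact hloop.snd.snd

theorem reverse {l : α → List β} (hl : PolyTime l) : PolyTime fun a => (l a).reverse := by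
  have : PolyTime fun a => (l a).foldl (fun acc x => x :: acc) [] :=
    foldl (f := fun _ acc x => x :: acc) (id.snd.snd.cons id.snd.fst) nil hl hl.polyBdd
      fun a l' h => by
        simpa [esize_reverse] using esize_le_of_sublist h.sublist
  simpa using this

theorem foldr {f : α → β → σ → σ} {s : α → σ} {l : α → List β}
    (hf : PolyTime fun x : α × β × σ => f x.1 x.2.1 x.2.2) (hs : PolyTime s) (hl : PolyTime l)
    {B : α → ℕ} (hB : PolyBdd B)
    (h : ∀ a l', l' <:+ l a → esize (l'.foldr (f a) (s a)) ≤ B a) :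
    PolyTime fun a => (l a).foldr (f a) (s a) := by
  have : PolyTime fun a => (l a).reverse.foldl (fun acc x => f a x acc) (s a) :=
    foldl (f := fun a acc x => f a x acc)
      (hf.comp (f := fun x : α × σ × β => (x.1, x.2.2, x.2.1))
        (id.fst.pair (id.snd.snd.pair id.snd.fst))) hs hl.reverse hB fun a l' hl' => by
        have := h a l'.reverse (by simpa using List.reverse_suffix.2 hl')
        simpa using this
  simpa using this

theorem append {l l' : α → List β} (hl : PolyTime l) (hl' : PolyTime l') :
    PolyTime fun a => l a ++ l' a := by
  have : PolyTime fun a => (l a).foldr (fun x acc => x :: acc) (l' a) :=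
    foldr (f := fun _ x acc => x :: acc) (id.snd.fst.cons id.snd.snd) hl' hl
      (hl.polyBdd.add hl'.polyBdd) fun a k h => by
        have h1 := esize_le_of_sublist h.sublist
        have h2 := esize_append k (l' a)
        have h3 : k.foldr (fun x acc => x :: acc) (l' a) = k ++ l' a := by simp
        rw [h3]; omega
  simpa using this

theorem map {f : α → β → γ} {l : α → List β} (hf : PolyTime fun x : α × β => f x.1 x.2)
    (hl : PolyTime l) : PolyTime fun a => (l a).map (f a) := by
  obtain ⟨q, hq⟩ := hf.polyBdd
  have : PolyTime fun a => (l a).foldr (fun x acc => f a x :: acc) [] := by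
    refine foldr (f := fun a x acc => f a x :: acc)
      ((hf.comp (f := fun x : α × β × List γ => (x.1, x.2.1)) (id.fst.pair id.snd.fst)).cons
        id.snd.snd) nil hl
      (B := fun a => esize (l a) * (q.eval (esize a + esize (l a) + 1) + 1) + 1)
      ((hl.polyBdd.mul ((((PolyBdd.size.add hl.polyBdd).add (PolyBdd.const 1)).eval q).add
        (PolyBdd.const 1))).add (PolyBdd.const 1)) fun a k h => ?_
    rw [← List.map_eq_foldr]
    refine (esize_list_le (B := q.eval (esize a + esize (l a) + 1)) fun y hy => ?_).trans ?_
    · obtain ⟨x, hx, rfl⟩ := List.mem_map.1 hy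
      refine (hq (a, x)).trans (eval_le_eval q ?_)
      have := esize_le_of_mem (h.subset hx)
      simp only [esize_prod]; omega
    · have : k.length ≤ esize (l a) := h.length_le.trans (length_le_esize _)
      simp only [List.length_map]
      gcongr
  simpa [← List.map_eq_foldr] using this

theorem esize_flatten_le (L : List (List α)) : esize L.flatten ≤ esize L := by
  induction L with
  | nil => rfl
  | cons l L ih => have := esize_append l L.flatten; simp; omega

theorem flatten {l : α → List (List β)} (hl : PolyTime l) : PolyTime fun a => (l a).flatten := by
  have h0 : ∀ k : List (List β), k.foldr (fun x acc => x ++ acc) [] = k.flatten := fun k => by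
    induction k with
    | nil => rfl
    | cons x k ih => simp [ih]
  have : PolyTime fun a => (l a).foldr (fun x acc => x ++ acc) [] :=
    foldr (f := fun _ x acc => x ++ acc) (id.snd.fst.append id.snd.snd) nil hl hl.polyBdd
      fun a k h => by
        have h1 := esize_le_of_sublist h.sublist
        rw [h0]
        exact (esize_flatten_le k).trans h1
  simpa only [h0] using this

theorem flatMap {f : α → β → List γ} {l : α → List β} (hf : PolyTime fun x : α × β => f x.1 x.2)
    (hl : PolyTime l) : PolyTime fun a => (l a).flatMap (f a) := by
  simpa [List.flatMap_def] using (hf.map hl).flatten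

theorem sum {l : α → List ℕ} (hl : PolyTime l) : PolyTime fun a => (l a).sum := by
  refine foldr (f := fun _ x acc => x + acc) (s := fun _ => 0)
    (id.snd.fst.add id.snd.snd) (nat 0) hl hl.polyBdd fun a k h => ?_
  refine le_trans ?_ (esize_le_of_sublist h.sublist)
  clear h
  induction k with
  | nil => simp
  | cons x k ih =>
    have := natSize_add_le x (k.foldr (fun x acc => x + acc) 0)
    simp at *; omega

theorem prod {l : α → List ℕ} (hl : PolyTime l) : PolyTime fun a => (l a).prod := by
  refine foldr (f := fun _ x acc => x * acc) (s := fun _ => 1)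
    (id.snd.fst.mul id.snd.snd) (nat 1) hl (hl.polyBdd.add (PolyBdd.const 1)) fun a k h => ?_
  refine le_trans ?_ (Nat.add_le_add_right (esize_le_of_sublist h.sublist) 1)
  clear h
  induction k with
  | nil => simp
  | cons x k ih =>
    have := natSize_mul_le x (k.foldr (fun x acc => x * acc) 1)
    simp at *; omega

theorem length {l : α → List β} (hl : PolyTime l) : PolyTime fun a => (l a).length := by
  simpa using (map (f := fun _ _ => 1) (nat 1) hl).sum

theorem take_one {l : α → List β} (hl : PolyTime l) : PolyTime fun a => (l a).take 1 := by
  have h0 : ∀ k : List β, k.foldr (fun x _ => [x]) [] = k.take 1 := by rintro (_ | _) <;> simp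
  have : PolyTime fun a => (l a).foldr (fun x _ => [x]) [] :=
    foldr (f := fun _ x _ => [x]) (id.snd.fst.cons nil) nil hl hl.polyBdd fun a k h => by
      rw [h0]
      exact esize_le_of_sublist ((List.take_sublist _ _).trans h.sublist)
  simpa only [h0] using this

end PolyTime

end TwoStage

namespace TwoStage

/-! ### The algorithm -/

/-- A weighted edge `(tail, head, cost, label)`. The label lists the arcs which are chosen in the
first stage when the edge is used. -/
abbrev Edge := ℕ × ℕ × ℕ × List ℕ

/-- The end node, the cost and the label of a walk. -/
abbrev Entry := ℕ × ℕ × List ℕ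

/-- An entry of minimum cost among those of `S` with end node `v`, as a list with at most one
element. -/
def best (S : List Entry) (v : ℕ) : List Entry :=
  S.foldr (fun e acc => if e.1 = v then
    (if (acc.flatMap fun b => if b.2.1 ≤ e.2.1 then [b] else []).isEmpty then [e] else acc)
    else acc) []

/-- One round of the Bellman–Ford algorithm: the best walks are extended by all edges. Besides the
empty walk, at most one walk per edge is kept. -/
def relax (E : List Edge) (s : ℕ) (S : List Entry) : List Entry :=
  (s, 0, []) :: E.flatMap fun e =>
    (best S e.1).map fun b => (e.2.1, b.2.1 + e.2.2.1, b.2.2 ++ e.2.2.2)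

/-- The Bellman–Ford algorithm with source `s` and one round for each element of `R`. The number of
rounds is given by a list because numbers are written in binary. -/
def bellmanFord {ρ : Type} (E : List Edge) (s : ℕ) (R : List ρ) : List Entry :=
  R.foldl (fun S _ => relax E s S) [(s, 0, [])]

/-- The combinatorial form of an instance in which all data are natural numbers: the terminals, the
arcs, the first-stage edges, and the edges of the scenarios. -/
abbrev IntInst := ℕ × ℕ × List (ℕ × ℕ) × List Edge × List (List Edge)

/-- The edges `(u, w)` which stand for a recourse path from `u` to `w`; the cost is the sum over the
scenarios of the cost of a shortest path. There is no such edge if no path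
exists, which does not depend on the scenario. -/
def recourseEdges (x : IntInst) : List Edge :=
  let nodes := x.1 :: x.2.1 :: (x.2.2.1.map (fun a => a.1) ++ x.2.2.1.map (fun a => a.2))
  nodes.flatMap fun u => nodes.flatMap fun w =>
    let b := x.2.2.2.2.flatMap fun E => best (bellmanFord E u x.2.2.1) w
    if b.isEmpty then [] else [(u, w, (b.map fun e => e.2.1).sum, [])]

/-- A shortest walk in the graph of first-stage edges and recourse edges. A first-stage solution
with `k` arcs corresponds to a walk with `2 * k + 1` edges, so twice the number of arcs plus one is
a sufficient number of rounds. -/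
def solveInt (x : IntInst) : List Entry :=
  best (bellmanFord (x.2.2.2.1 ++ recourseEdges x) x.1 ((0, 0) :: (x.2.2.1 ++ x.2.2.1))) x.2.1

/-- The form in which an instance is given. The last component is the end of the encoded list. -/
abbrev RawInst := ℕ × ℕ × ℕ × List (ℕ × ℕ) × List (ℕ × ℕ) × List (List (ℕ × ℕ)) ×
  List (ℕ × ℕ) × Unit

/-- The list of elements with their positions. -/
def positions {β : Type} (l : List β) : List (β × ℕ) :=
  l.foldl (fun acc x => acc ++ [(x, acc.length)]) []

/-- The pairs of elements at equal positions. -/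
def zipList {β γ : Type} (l : List β) (l' : List γ) : List (β × γ) :=
  (l.foldl (fun acc x => (acc.1.tail, acc.2 ++ (acc.1.take 1).map fun y => (x, y))) (l', [])).2

/-- The product of the denominators. -/
def denProd (l : List (ℕ × ℕ)) : ℕ := (l.map fun q => q.2).prod

/-- The numerator of a fraction after expansion to the denominator `M`. -/
def expand (M : ℕ) (q : ℕ × ℕ) : ℕ := q.1 * (M / q.2)

/-- A common denominator of all numbers of an instance. -/
def commonDen (r : RawInst) : ℕ :=
  denProd r.2.2.2.2.1 * (denProd r.2.2.2.2.2.1.flatten * denProd r.2.2.2.2.2.2.1)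

/-- Scaling to integral costs; the costs of a scenario are multiplied by its probability. -/
def integerInst (r : RawInst) : IntInst :=
  (r.2.1, r.2.2.1, r.2.2.2.1,
    (positions (zipList r.2.2.2.1 r.2.2.2.2.1)).map fun a =>
      (a.1.1.1, a.1.1.2, commonDen r * expand (commonDen r) a.1.2, [a.2]),
    (zipList r.2.2.2.2.2.1 r.2.2.2.2.2.2.1).map fun c =>
      (zipList r.2.2.2.1 c.1).map fun a =>
        (a.1.1, a.1.2, expand (commonDen r) c.2 * expand (commonDen r) a.2, []))

/-- The algorithm: the output is the list of multiplicities of the arcs in the label of an optimal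
walk. -/
def solve (r : RawInst) : List ℕ :=
  (positions r.2.2.2.1).map fun a =>
    (((solveInt (integerInst r)).flatMap fun b => b.2.2).map fun i =>
      if i = a.2 then 1 else 0).sum

/-! ### The algorithm runs in polynomial time -/

variable {α β γ ρ : Type} [Enc α] [Enc β] [Enc γ] [Enc ρ]

theorem best_sublist (S : List Entry) (v : ℕ) : (best S v).Sublist S := by
  induction S with
  | nil => exact .slnil
  | cons e S ih =>
    simp only [best, List.foldr_cons]
    split_ifs
    · simp
    · exact ih.cons e
    · exact ih.cons e

theorem best_length_le (S : List Entry) (v : ℕ) : (best S v).length ≤ 1 := by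
  induction S with
  | nil => simp [best]
  | cons e S ih =>
    simp only [best, List.foldr_cons]
    split_ifs
    · simp
    · exact ih
    · exact ih

theorem relax_length_le (E : List Edge) (s : ℕ) (S : List Entry) :
    (relax E s S).length ≤ E.length + 1 := by
  simp only [relax, List.length_cons, add_le_add_iff_right]
  induction E with
  | nil => simp
  | cons e E ih =>
    have := best_length_le S e.1
    simp at *; omega

theorem esize_relax_le (E : List Edge) (s : ℕ) {S : List Entry} {B : ℕ}
    (hS : ∀ b ∈ S, esize b ≤ B) : ∀ b ∈ relax E s S, esize b ≤ B + esize E + esize s + 5 := by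
  intro b hb
  rcases List.mem_cons.1 hb with rfl | hb
  · simp; omega
  · obtain ⟨e, he, hb⟩ := List.mem_flatMap.1 hb
    obtain ⟨c, hc, rfl⟩ := List.mem_map.1 hb
    have h1 := esize_le_of_mem he
    have h2 := hS c ((best_sublist S _).subset hc)
    have h3 := natSize_add_le c.2.1 e.2.2.1
    have h4 := esize_append c.2.2 e.2.2.2
    simp only [esize_prod, esize_nat] at *
    omega

/-- The entries grow by a bounded amount in each round, and there are never more than one plus the
number of edges. -/
theorem esize_bellmanFord_le {B : ℕ} (E : List Edge) (s : ℕ) (R : List ρ) (hE : esize E ≤ B)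
    (hs : esize s ≤ B) (hR : esize R ≤ B) :
    esize (bellmanFord E s R) ≤ (B + 1) * ((B + 1) * (2 * B + 5) + 1) + 1 := by
  have key : ∀ R : List ρ, (∀ b ∈ bellmanFord E s R, esize b ≤ (R.length + 1) * (2 * B + 5)) ∧
      (bellmanFord E s R).length ≤ E.length + 1 := by
    intro R
    induction R using List.reverseRecOn with
    | nil =>
      refine ⟨fun b hb => ?_, by simp [bellmanFord]⟩
      obtain rfl : b = (s, 0, []) := by simpa [bellmanFord] using hb
      simp only [esize_prod, esize_nat, esize_nil, Nat.size_zero, List.length_nil] at *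
      omega
    | append_singleton R x ih =>
      have h : bellmanFord E s (R ++ [x]) = relax E s (bellmanFord E s R) := by
        simp [bellmanFord]
      rw [h]
      refine ⟨fun b hb => (esize_relax_le E s ih.1 b hb).trans ?_, relax_length_le _ _ _⟩
      rw [List.length_append, List.length_singleton, add_mul (R.length + 1), one_mul]
      omega
  have h1 := length_le_esize R
  have h2 := length_le_esize E
  refine (esize_list_le (key R).1).trans ?_
  gcongr
  · exact (key R).2.trans (by omega)
  · omega

namespace PolyTime

theorem best {S : α → List Entry} {v : α → ℕ} (hS : PolyTime S) (hv : PolyTime v) :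
    PolyTime fun a => best (S a) (v a) := by
  refine foldr (f := fun a (e : Entry) (acc : List Entry) => if e.1 = v a then
    (if (acc.flatMap fun b : Entry => if b.2.1 ≤ e.2.1 then [b] else []).isEmpty then [e] else acc)
    else acc) ?_ nil hS hS.polyBdd fun a l h =>
      esize_le_of_sublist ((best_sublist l (v a)).trans h.sublist)
  refine ite_eq id.snd.fst.fst (hv.comp id.fst) (ite_isEmpty (flatMap ?_ id.snd.snd)
    (id.snd.fst.cons nil) id.snd.snd) id.snd.snd
  exact ite_le id.snd.snd.fst id.fst.snd.fst.snd.fst (id.snd.cons nil) nil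

theorem bellmanFord {E : α → List Edge} {s : α → ℕ} {R : α → List ρ} (hE : PolyTime E)
    (hs : PolyTime s) (hR : PolyTime R) : PolyTime fun a => bellmanFord (E a) (s a) (R a) := by
  have hstart : PolyTime fun a => ((s a, 0, []) : Entry) := hs.pair ((nat 0).pair nil)
  have hB := (hE.polyBdd.add hs.polyBdd).add hR.polyBdd
  refine foldl (f := fun a S _ => relax (E a) (s a) S) ?_ (hstart.cons nil) hR
    (((hB.add (.const 1)).mul
      (((hB.add (.const 1)).mul (((PolyBdd.const 2).mul hB).add (.const 5))).add
        (.const 1))).add (.const 1)) fun a l h => ?_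
  · refine cons (hstart.comp id.fst) (flatMap (map ?_ (best id.fst.snd.fst id.snd.fst))
      (hE.comp id.fst))
    exact id.fst.snd.snd.fst.pair ((id.snd.snd.fst.add id.fst.snd.snd.snd.fst).pair
      (id.snd.snd.snd.append id.fst.snd.snd.snd.snd))
  · have := esize_le_of_sublist h.sublist
    exact esize_bellmanFord_le (E a) (s a) l (by omega) (by omega) (by omega)

theorem recourseEdges : PolyTime recourseEdges := by
  have hnodes : PolyTime fun x : IntInst =>
      x.1 :: x.2.1 :: (x.2.2.1.map (fun a => a.1) ++ x.2.2.1.map (fun a => a.2)) :=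
    id.fst.cons (id.snd.fst.cons
      ((map (f := fun _ (a : ℕ × ℕ) => a.1) id.snd.fst id.snd.snd.fst).append
      (map (f := fun _ (a : ℕ × ℕ) => a.2) id.snd.snd id.snd.snd.fst)))
  have hb : PolyTime fun y : (IntInst × ℕ) × ℕ => y.1.1.2.2.2.2.flatMap fun E =>
      TwoStage.best (TwoStage.bellmanFord E y.1.2 y.1.1.2.2.1) y.2 :=
    flatMap (best (bellmanFord id.snd id.fst.fst.snd id.fst.fst.fst.snd.snd.fst) id.fst.snd)
      id.fst.fst.snd.snd.snd.snd
  refine flatMap (flatMap ?_ (hnodes.comp id.fst)) hnodes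
  exact ite_isEmpty hb nil (cons (id.fst.snd.pair (id.snd.pair
    ((sum (map (f := fun _ e => e.2.1) id.snd.snd.fst hb)).pair nil))) nil)

theorem solveInt : PolyTime solveInt :=
  best (bellmanFord (id.snd.snd.snd.fst.append recourseEdges) id.fst
    (((nat 0).pair (nat 0)).cons (id.snd.snd.fst.append id.snd.snd.fst))) id.snd.fst

end PolyTime

theorem positions_eq {β : Type} (l : List β) : positions l = l.zipIdx := by
  induction l using List.reverseRecOn with
  | nil => rfl
  | append_singleton l x ih =>
    have h : positions (l ++ [x]) = positions l ++ [(x, (positions l).length)] := by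
      simp [positions]
    rw [h, ih, List.zipIdx_append]
    simp

theorem foldl_zip {β γ : Type} (l : List β) (l' : List γ) (acc : List (β × γ)) :
    l.foldl (fun acc x => (acc.1.tail, acc.2 ++ (acc.1.take 1).map fun y => (x, y))) (l', acc) =
      (l'.drop l.length, acc ++ l.zip l') := by
  induction l generalizing l' acc with
  | nil => simp
  | cons x l ih => cases l' <;> simp [ih, -List.map_take]

theorem zipList_eq {β γ : Type} (l : List β) (l' : List γ) : zipList l l' = l.zip l' := by
  simp [zipList, foldl_zip, -List.map_take]

namespace PolyTime

theorem positions {l : α → List β} (hl : PolyTime l) : PolyTime fun a => positions (l a) := by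
  refine foldl (f := fun _ acc x => acc ++ [(x, acc.length)])
    (id.snd.fst.append ((id.snd.snd.pair id.snd.fst.length).cons nil)) nil hl
    ((hl.polyBdd.mul (((hl.polyBdd.add hl.polyBdd).add (.const 2)).add (.const 1))).add
      (.const 1)) fun a l' h => ?_
  change esize (TwoStage.positions l') ≤ _
  have h1 := esize_le_of_sublist h.sublist
  have h2 := length_le_esize l'
  rw [positions_eq]
  refine (esize_list_le (B := esize (l a) + esize (l a) + 2) fun x hx => ?_).trans ?_
  · have h3 := List.fst_mem_of_mem_zipIdx hx
    have h4 := esize_le_of_mem h3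
    have h5 := List.snd_lt_of_mem_zipIdx hx
    have h6 : Nat.size x.2 ≤ x.2 := Nat.size_le.2 Nat.lt_two_pow_self
    simp only [esize_prod, esize_nat]
    omega
  · rw [List.length_zipIdx]
    gcongr
    exact h2.trans h1

theorem zipList {l : α → List β} {l' : α → List γ} (hl : PolyTime l) (hl' : PolyTime l') :
    PolyTime fun a => zipList (l a) (l' a) := by
  refine snd (foldl (f := fun _ acc x =>
      (acc.1.tail, acc.2 ++ (acc.1.take 1).map fun y => (x, y)))
    (id.snd.fst.fst.tail.pair (id.snd.fst.snd.append (map (id.fst.snd.snd.pair id.snd)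
      id.snd.fst.fst.take_one))) (s := fun a => (l' a, [])) (hl'.pair nil) hl
    (B := fun a => esize (l' a) +
      (esize (l a) * ((esize (l a) + esize (l' a) + 1) + 1) + 1) + 1) ?_ fun a k h => ?_)
  · exact ((hl'.polyBdd.add ((hl.polyBdd.mul (((hl.polyBdd.add hl'.polyBdd).add (.const 1)).add
      (.const 1))).add (.const 1))).add (.const 1))
  · rw [foldl_zip]
    have h1 := esize_le_of_sublist h.sublist
    have h2 := (length_le_esize k).trans h1
    have h3 := esize_le_of_sublist (List.drop_sublist k.length (l' a))
    have h4 : esize ([] ++ k.zip (l' a)) ≤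
        esize (l a) * ((esize (l a) + esize (l' a) + 1) + 1) + 1 := by
      refine (esize_list_le (B := esize (l a) + esize (l' a) + 1) fun x hx => ?_).trans ?_
      · have hx := List.of_mem_zip (List.nil_append _ ▸ hx)
        have h5 := esize_le_of_mem hx.1
        have h6 := esize_le_of_mem hx.2
        simp only [esize_prod]
        omega
      · gcongr
        rw [List.nil_append, List.length_zip]
        omega
    simp only [esize_prod]
    omega

theorem denProd {l : α → List (ℕ × ℕ)} (hl : PolyTime l) : PolyTime fun a => denProd (l a) :=
  prod (map (f := fun _ q => q.2) id.snd.snd hl)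

theorem expand {M : α → ℕ} {q : α → ℕ × ℕ} (hM : PolyTime M) (hq : PolyTime q) :
    PolyTime fun a => expand (M a) (q a) :=
  hq.fst.mul (hM.div hq.snd)

theorem commonDen : PolyTime commonDen :=
  (denProd id.snd.snd.snd.snd.fst).mul ((denProd id.snd.snd.snd.snd.snd.fst.flatten).mul
    (denProd id.snd.snd.snd.snd.snd.snd.fst))

theorem integerInst : PolyTime integerInst := by
  refine id.snd.fst.pair (id.snd.snd.fst.pair (id.snd.snd.snd.fst.pair (pair
    (map ?_ (positions (zipList id.snd.snd.snd.fst id.snd.snd.snd.snd.fst)))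
    (map (map ?_ (zipList id.fst.snd.snd.snd.fst id.snd.fst))
      (zipList id.snd.snd.snd.snd.snd.fst id.snd.snd.snd.snd.snd.snd.fst)))))
  · exact id.snd.fst.fst.fst.pair (id.snd.fst.fst.snd.pair
      (((commonDen.comp id.fst).mul (expand (commonDen.comp id.fst) id.snd.fst.snd)).pair
        (id.snd.snd.cons nil)))
  · exact id.snd.fst.fst.pair (id.snd.fst.snd.pair
      (((expand (commonDen.comp id.fst.fst) id.fst.snd.snd).mul
        (expand (commonDen.comp id.fst.fst) id.snd.snd)).pair nil))

theorem solve : PolyTime solve := by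
  refine map (sum (map (ite_eq id.snd id.fst.snd.snd (nat 1) (nat 0))
    (flatMap (f := fun _ b => b.2.2) id.snd.snd.snd
      (solveInt.comp (integerInst.comp id.fst))))) (positions id.snd.snd.snd.fst)

end PolyTime

end TwoStage

namespace TwoStage

/-! ### Correctness of the Bellman–Ford algorithm -/

/-- `W` is a walk from `u` to `v` along edges of `E`. -/
def IsEdgeWalk (E : List Edge) : ℕ → List Edge → ℕ → Prop
  | u, [], v => u = v
  | u, e :: W, v => e ∈ E ∧ e.1 = u ∧ IsEdgeWalk E e.2.1 W v

/-- The cost of a sequence of edges. -/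
def edgeCost (W : List Edge) : ℕ := (W.map fun e => e.2.2.1).sum

/-- The label of a sequence of edges. -/
def edgeLabel (W : List Edge) : List ℕ := W.flatMap fun e => e.2.2.2

theorem isEdgeWalk_append {E : List Edge} {u v : ℕ} {W W' : List Edge} :
    IsEdgeWalk E u (W ++ W') v ↔ ∃ z, IsEdgeWalk E u W z ∧ IsEdgeWalk E z W' v := by
  induction W generalizing u with
  | nil => simp [IsEdgeWalk]
  | cons e W ih => simp [IsEdgeWalk, ih, and_assoc]

theorem mem_best {S : List Entry} {v : ℕ} {b : Entry} (h : b ∈ best S v) : b ∈ S ∧ b.1 = v := by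
  refine ⟨(best_sublist S v).subset h, ?_⟩
  induction S with
  | nil => simp [best] at h
  | cons e S ih =>
    simp only [best, List.foldr_cons] at h
    split_ifs at h with h1
    · rw [List.mem_singleton.1 h, h1]
    · exact ih h
    · exact ih h

theorem exists_mem_best_le {S : List Entry} {v : ℕ} {e : Entry} (h : e ∈ S) (hv : e.1 = v) :
    ∃ b ∈ best S v, b.2.1 ≤ e.2.1 := by
  induction S with
  | nil => simp at h
  | cons e' S ih =>
    change ∃ b ∈ (if e'.1 = v then
      (if ((best S v).flatMap fun b => if b.2.1 ≤ e'.2.1 then [b] else []).isEmpty then [e']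
        else best S v) else best S v), b.2.1 ≤ e.2.1
    rcases List.mem_cons.1 h with rfl | h
    · rw [if_pos hv]
      split_ifs with h1
      · exact ⟨e, by simp, le_rfl⟩
      · simp only [List.isEmpty_iff, List.flatMap_eq_nil_iff] at h1
        push Not at h1
        obtain ⟨b, hb, h1⟩ := h1
        refine ⟨b, hb, ?_⟩
        by_contra h2
        exact h1 (if_neg h2)
    · obtain ⟨b, hb, hbe⟩ := ih h
      split_ifs with h1 h2
      · refine ⟨e', by simp, le_trans ?_ hbe⟩
        simp only [List.isEmpty_iff, List.flatMap_eq_nil_iff] at h2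
        by_contra h3
        have := h2 b hb
        rw [if_pos (by omega)] at this
        simp at this
      · exact ⟨b, hb, hbe⟩
      · exact ⟨b, hb, hbe⟩

theorem bellmanFord_concat {ρ : Type} (E : List Edge) (s : ℕ) (R : List ρ) (x : ρ) :
    bellmanFord E s (R ++ [x]) = relax E s (bellmanFord E s R) := by
  simp [bellmanFord]

theorem bellmanFord_sound {ρ : Type} {E : List Edge} {s : ℕ} {R : List ρ} {b : Entry}
    (h : b ∈ bellmanFord E s R) :
    ∃ W, IsEdgeWalk E s W b.1 ∧ edgeCost W = b.2.1 ∧ edgeLabel W = b.2.2 := by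
  induction R using List.reverseRecOn generalizing b with
  | nil =>
    obtain rfl : b = (s, 0, []) := by simpa [bellmanFord] using h
    exact ⟨[], rfl, rfl, rfl⟩
  | append_singleton R x ih =>
    rw [bellmanFord_concat] at h
    rcases List.mem_cons.1 h with rfl | h
    · exact ⟨[], rfl, rfl, rfl⟩
    · obtain ⟨e, he, h⟩ := List.mem_flatMap.1 h
      obtain ⟨c, hc, rfl⟩ := List.mem_map.1 h
      obtain ⟨hc, hce⟩ := mem_best hc
      obtain ⟨W, h1, h2, h3⟩ := ih hc
      refine ⟨W ++ [e], isEdgeWalk_append.2 ⟨_, h1, he, hce.symm, rfl⟩, ?_, ?_⟩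
      · simp [edgeCost, ← h2]
      · simp [edgeLabel, ← h3]

theorem bellmanFord_complete {ρ : Type} {E : List Edge} {s v : ℕ} {R : List ρ} {W : List Edge}
    (h : IsEdgeWalk E s W v) (hW : W.length ≤ R.length) :
    ∃ b ∈ bellmanFord E s R, b.1 = v ∧ b.2.1 ≤ edgeCost W := by
  induction R using List.reverseRecOn generalizing v W with
  | nil =>
    obtain rfl : W = [] := by simpa using hW
    exact ⟨(s, 0, []), by simp [bellmanFord], h, by simp⟩
  | append_singleton R x ih =>
    rw [bellmanFord_concat]
    induction W using List.reverseRecOn with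
    | nil => exact ⟨(s, 0, []), by simp [relax], h, by simp⟩
    | append_singleton W e _ =>
      obtain ⟨z, h1, he, rfl, rfl⟩ := isEdgeWalk_append.1 h
      obtain ⟨b, hb, hbz, hbc⟩ := ih h1 (by simpa using hW)
      obtain ⟨c, hc, hcb⟩ := exists_mem_best_le hb hbz
      refine ⟨(e.2.1, c.2.1 + e.2.2.1, c.2.2 ++ e.2.2.2), ?_, rfl, ?_⟩
      · exact List.mem_cons_of_mem _ (List.mem_flatMap.2 ⟨e, he, List.mem_map.2 ⟨c, hc, rfl⟩⟩)
      · simp only [edgeCost, List.map_append, List.sum_append, List.map_cons, List.map_nil,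
          List.sum_singleton] at *
        omega

/-! ### Walks in acyclic networks -/

namespace Network

variable {G : Network}

theorem isWalk_append {u v : Fin G.n} {L L' : List (Fin G.m)} :
    G.IsWalk u (L ++ L') v ↔ ∃ z, G.IsWalk u L z ∧ G.IsWalk z L' v := by
  induction L generalizing u with
  | nil => simp [IsWalk]
  | cons e W ih => simp [IsWalk, ih, and_assoc]

/-- A potential which strictly increases along every arc. -/
def IsPotential (G : Network) (φ : Fin G.n → ℝ) : Prop := ∀ a, φ (G.tail a) < φ (G.head a)

theorem IsPotential.pairwise {φ : Fin G.n → ℝ} (hφ : G.IsPotential φ) {u v : Fin G.n}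
    {L : List (Fin G.m)} (h : G.IsWalk u L v) :
    (u :: L.map G.head).Pairwise fun x y => φ x < φ y := by
  induction L generalizing u with
  | nil => simp
  | cons a L ih =>
    obtain ⟨rfl, h⟩ := h
    have h1 := ih h
    refine List.pairwise_cons.2 ⟨fun x hx => ?_, by simpa using h1⟩
    rcases List.mem_cons.1 (by simpa using hx : x ∈ G.head a :: L.map G.head) with rfl | hx
    · exact hφ a
    · exact (hφ a).trans ((List.pairwise_cons.1 h1).1 x hx)

theorem IsPotential.pairwise_head {φ : Fin G.n → ℝ} (hφ : G.IsPotential φ) {u v : Fin G.n}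
    {L : List (Fin G.m)} (h : G.IsWalk u L v) :
    L.Pairwise fun a b => φ (G.head a) < φ (G.head b) :=
  (List.pairwise_map (R := fun x y => φ x < φ y)).1 (List.pairwise_cons.1 (hφ.pairwise h)).2

theorem IsPotential.nodup {φ : Fin G.n → ℝ} (hφ : G.IsPotential φ) {u v : Fin G.n}
    {L : List (Fin G.m)} (h : G.IsWalk u L v) : L.Nodup :=
  (hφ.pairwise_head h).imp fun {_ _} hab => by rintro rfl; exact lt_irrefl _ hab

theorem IsPotential.length_le {φ : Fin G.n → ℝ} (hφ : G.IsPotential φ) {u v : Fin G.n}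
    {L : List (Fin G.m)} (h : G.IsWalk u L v) : L.length ≤ G.m := by
  simpa using (hφ.nodup h).length_le_card

/-- In an acyclic network, every walk from `s` to `t` is a simple path. -/
theorem IsPotential.isSimplePath {φ : Fin G.n → ℝ} (hφ : G.IsPotential φ)
    {L : List (Fin G.m)} (h : G.IsWalk G.s L G.t) : G.IsSimplePath L :=
  ⟨h, (hφ.pairwise h).imp fun {_ _} hab => by rintro rfl; exact lt_irrefl _ hab⟩

/-- The edge for choosing the arc `a`, of cost `f a`, in the first stage. -/
def firstEdge (G : Network) (f : Fin G.m → ℕ) (a : Fin G.m) : Edge :=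
  (G.tail a, G.head a, f a, [(a : ℕ)])

/-- The edge for using the arc `a`, of cost `f a`, as recourse. -/
def plainEdge (G : Network) (f : Fin G.m → ℕ) (a : Fin G.m) : Edge :=
  (G.tail a, G.head a, f a, [])

/-- The integral instance with first-stage costs `f` and scenarios `g`. -/
def intInst (G : Network) {K : ℕ} (f : Fin G.m → ℕ) (g : Fin K → Fin G.m → ℕ) : IntInst :=
  (G.s, G.t, List.ofFn fun a => ((G.tail a : ℕ), (G.head a : ℕ)), List.ofFn (G.firstEdge f),
    List.ofFn fun j => List.ofFn (G.plainEdge (g j)))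

theorem IsWalk.isEdgeWalk {f : Fin G.m → ℕ} {u v : Fin G.n} {L : List (Fin G.m)}
    (h : G.IsWalk u L v) :
    IsEdgeWalk (List.ofFn (G.plainEdge f)) u (L.map (G.plainEdge f)) v := by
  induction L generalizing u with
  | nil => exact congrArg _ h
  | cons a L ih =>
    obtain ⟨rfl, h⟩ := h
    exact ⟨List.mem_ofFn.2 ⟨a, rfl⟩, rfl, ih h⟩

theorem exists_isWalk {f : Fin G.m → ℕ} {u : Fin G.n} {v : ℕ} {W : List Edge}
    (h : IsEdgeWalk (List.ofFn (G.plainEdge f)) u W v) :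
    ∃ z : Fin G.n, v = z ∧ ∃ L, G.IsWalk u L z ∧ edgeCost W = (L.map f).sum := by
  induction W generalizing u with
  | nil => exact ⟨u, h.symm, [], rfl, rfl⟩
  | cons e W ih =>
    obtain ⟨he, heu, h⟩ := h
    obtain ⟨a, rfl⟩ := List.mem_ofFn.1 he
    obtain ⟨z, rfl, L, hL, hc⟩ := ih (u := G.head a) h
    refine ⟨z, rfl, a :: L, ⟨Fin.ext heu, hL⟩, ?_⟩
    simp only [edgeCost, List.map_cons, List.sum_cons] at *
    rw [hc]; rfl

theorem best_sound {ρ : Type} {f : Fin G.m → ℕ} {u : Fin G.n} {v : ℕ} {R : List ρ} {b : Entry}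
    (h : b ∈ best (bellmanFord (List.ofFn (G.plainEdge f)) u R) v) :
    ∃ z : Fin G.n, v = z ∧ ∃ L, G.IsWalk u L z ∧ b.2.1 = (L.map f).sum := by
  obtain ⟨h1, rfl⟩ := mem_best h
  obtain ⟨W, hW, hc, -⟩ := bellmanFord_sound h1
  rw [← hc]
  exact exists_isWalk hW

theorem best_complete {ρ : Type} {φ : Fin G.n → ℝ} (hφ : G.IsPotential φ) {f : Fin G.m → ℕ}
    {u v : Fin G.n} {R : List ρ} (hR : G.m ≤ R.length) {L : List (Fin G.m)}
    (h : G.IsWalk u L v) :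
    ∃ b ∈ best (bellmanFord (List.ofFn (G.plainEdge f)) u R) v, b.2.1 ≤ (L.map f).sum := by
  obtain ⟨b, hb, hbv, hc⟩ := bellmanFord_complete (R := R) (h.isEdgeWalk (f := f))
    (by simpa using (hφ.length_le h).trans hR)
  obtain ⟨c, hc', hcb⟩ := exists_mem_best_le hb hbv
  refine ⟨c, hc', hcb.trans (hc.trans_eq ?_)⟩
  simp [edgeCost, Function.comp_def, plainEdge]

theorem flatMap_ofFn_of_singleton {α β : Type} {K : ℕ} {h : Fin K → α} {k : α → List β}
    {b : Fin K → β} (hb : ∀ j, k (h j) = [b j]) : (List.ofFn h).flatMap k = List.ofFn b := by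
  induction K with
  | zero => simp
  | succ K ih => simp [List.ofFn_succ, hb, ih (h := fun i => h i.succ) (b := fun i => b i.succ)]

variable {K : ℕ} {f : Fin G.m → ℕ} {g : Fin K → Fin G.m → ℕ}

/-- If `u` and `w` are connected, then `b j` is the entry of a shortest path in scenario `j`. -/
theorem exists_best {φ : Fin G.n → ℝ} (hφ : G.IsPotential φ) {u w : Fin G.n}
    {L : Fin K → List (Fin G.m)} (hL : ∀ j, G.IsWalk u (L j) w) :
    ∃ b : Fin K → Entry, ((G.intInst f g).2.2.2.2.flatMap fun E =>
        best (bellmanFord E u (G.intInst f g).2.2.1) w) = List.ofFn b ∧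
      ∀ j, b j ∈ best (bellmanFord (List.ofFn (G.plainEdge (g j))) u (G.intInst f g).2.2.1) w ∧
        (b j).2.1 ≤ ((L j).map (g j)).sum := by
  have h : ∀ j, ∃ b,
      best (bellmanFord (List.ofFn (G.plainEdge (g j))) u (G.intInst f g).2.2.1) w = [b] ∧
        b.2.1 ≤ ((L j).map (g j)).sum := fun j => by
    obtain ⟨b, hb, hc⟩ := best_complete (f := g j) (R := (G.intInst f g).2.2.1) hφ
      (by simp [intInst]) (hL j)
    obtain ⟨b', hb'⟩ := List.length_eq_one_iff.1 (le_antisymm (best_length_le _ _)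
      (List.length_pos_of_mem hb))
    rw [hb'] at hb
    obtain rfl := List.mem_singleton.1 hb
    exact ⟨b, hb', hc⟩
  choose b hb hc using h
  exact ⟨b, flatMap_ofFn_of_singleton hb, fun j => ⟨by rw [hb j]; simp, hc j⟩⟩

/-- The nodes which occur in a recourse edge. -/
def terminalNodes (G : Network) : List ℕ :=
  (G.s : ℕ) :: (G.t : ℕ) ::
    ((List.ofFn fun a => (G.tail a : ℕ)) ++ List.ofFn fun a => (G.head a : ℕ))

theorem mem_recourseEdges {e : Edge} : e ∈ recourseEdges (G.intInst f g) ↔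
    ∃ u ∈ G.terminalNodes, ∃ w ∈ G.terminalNodes, ∃ b : List Entry,
      ((G.intInst f g).2.2.2.2.flatMap fun E =>
        best (bellmanFord E u (G.intInst f g).2.2.1) w) = b ∧ b ≠ [] ∧
      e = (u, w, (b.map fun e => e.2.1).sum, []) := by
  have h : (G.intInst f g).1 :: (G.intInst f g).2.1 ::
      ((G.intInst f g).2.2.1.map (fun a => a.1) ++ (G.intInst f g).2.2.1.map (fun a => a.2)) =
      G.terminalNodes := by
    simp [intInst, terminalNodes, List.map_ofFn, Function.comp_def]
  simp only [recourseEdges, h, List.mem_flatMap]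
  refine exists_congr fun u => and_congr_right fun _ => exists_congr fun w =>
    and_congr_right fun _ => ?_
  simp only [exists_eq_left']
  split_ifs with h1
  · rw [List.isEmpty_iff] at h1
    simp [h1]
  · rw [List.isEmpty_iff] at h1
    simp [h1]

theorem exists_fin_of_mem_terminalNodes {u : ℕ} (h : u ∈ G.terminalNodes) :
    ∃ z : Fin G.n, u = z := by
  simp only [terminalNodes, List.mem_cons, List.mem_append, List.mem_ofFn] at h
  rcases h with h | h | ⟨a, h⟩ | ⟨a, h⟩
  exacts [⟨_, h⟩, ⟨_, h⟩, ⟨_, h.symm⟩, ⟨_, h.symm⟩]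

theorem recourseEdges_sound {φ : Fin G.n → ℝ} (hφ : G.IsPotential φ) {e : Edge}
    (h : e ∈ recourseEdges (G.intInst f g)) : ∃ (u w : Fin G.n) (L : Fin K → List (Fin G.m)),
      (∀ j, G.IsWalk u (L j) w) ∧ e = (↑u, ↑w, ∑ j, ((L j).map (g j)).sum, []) := by
  obtain ⟨u, hu, w, hw, b, hb, hne, rfl⟩ := mem_recourseEdges.1 h
  obtain ⟨u, rfl⟩ := exists_fin_of_mem_terminalNodes hu
  obtain ⟨w, rfl⟩ := exists_fin_of_mem_terminalNodes hw
  obtain ⟨c, hc⟩ := List.exists_mem_of_ne_nil b hne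
  rw [← hb] at hc
  obtain ⟨E, hE, hc⟩ := List.mem_flatMap.1 hc
  obtain ⟨i, rfl⟩ := List.mem_ofFn.1 hE
  obtain ⟨z, hz, L₀, hL₀, -⟩ := best_sound hc
  obtain rfl := Fin.ext hz
  -- A path found in one scenario shows that all scenarios have one.
  obtain ⟨b', hb', h'⟩ := exists_best (f := f) (g := g) hφ (L := fun _ => L₀) fun _ => hL₀
  have h2 : ∀ j, ∃ L, G.IsWalk u L w ∧ (b' j).2.1 = (L.map (g j)).sum := fun j => by
    obtain ⟨z, hz, L, hL, hc⟩ := best_sound (h' j).1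
    obtain rfl := Fin.ext hz
    exact ⟨L, hL, hc⟩
  choose L hL hc using h2
  refine ⟨u, w, L, hL, ?_⟩
  rw [← hb, hb', List.map_ofFn, List.sum_ofFn]
  simp [hc]

theorem recourseEdges_complete (hK : 0 < K) {φ : Fin G.n → ℝ} (hφ : G.IsPotential φ)
    {u w : Fin G.n} (hu : (u : ℕ) ∈ G.terminalNodes) (hw : (w : ℕ) ∈ G.terminalNodes)
    {L : Fin K → List (Fin G.m)} (hL : ∀ j, G.IsWalk u (L j) w) :
    ∃ c ≤ ∑ j, ((L j).map (g j)).sum, (↑u, ↑w, c, []) ∈ recourseEdges (G.intInst f g) := by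
  obtain ⟨b, hb, h⟩ := exists_best (f := f) (g := g) hφ hL
  refine ⟨((List.ofFn b).map fun e => e.2.1).sum, ?_,
    mem_recourseEdges.2 ⟨u, hu, w, hw, _, hb, ?_, rfl⟩⟩
  · rw [List.map_ofFn, List.sum_ofFn]
    exact Finset.sum_le_sum fun j _ => (h j).2
  · intro h0
    have := congrArg List.length h0
    simp at this
    omega

/-- The walks in the auxiliary graph are first-stage solutions together with recourse actions. -/
theorem auxiliary_sound {φ : Fin G.n → ℝ} (hφ : G.IsPotential φ) {u : Fin G.n} {v : ℕ}
    {W : List Edge}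
    (h : IsEdgeWalk (List.ofFn (G.firstEdge f) ++ recourseEdges (G.intInst f g)) u W v) :
    ∃ (z : Fin G.n) (l : List (Fin G.m)) (L y : Fin K → List (Fin G.m)), v = z ∧
      edgeLabel W = l.map Fin.val ∧ (∀ j, G.IsWalk u (L j) z) ∧ (∀ j, (L j).Perm (l ++ y j)) ∧
      edgeCost W = (l.map f).sum + ∑ j, ((y j).map (g j)).sum := by
  induction W generalizing u with
  | nil => exact ⟨u, [], fun _ => [], fun _ => [], h.symm, rfl, fun _ => rfl, by simp,
      by simp [edgeCost]⟩
  | cons e W ih =>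
    obtain ⟨he, heu, h⟩ := h
    rcases List.mem_append.1 he with he | he
    · obtain ⟨a, rfl⟩ := List.mem_ofFn.1 he
      obtain ⟨z, l, L, y, rfl, h1, h2, h3, h4⟩ := ih (u := G.head a) h
      refine ⟨z, a :: l, fun j => a :: L j, y, rfl, ?_, fun j => ⟨Fin.ext heu, h2 j⟩,
        fun j => (h3 j).cons a, ?_⟩
      · simp only [edgeLabel, List.flatMap_cons] at *
        rw [h1]; rfl
      · simp only [edgeCost, List.map_cons, List.sum_cons] at *
        rw [h4, add_assoc]; rfl
    · obtain ⟨u', w, P, hP, rfl⟩ := recourseEdges_sound hφ he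
      obtain ⟨z, l, L, y, rfl, h1, h2, h3, h4⟩ := ih (u := w) h
      obtain rfl : u' = u := Fin.ext heu
      refine ⟨z, l, fun j => P j ++ L j, fun j => P j ++ y j, rfl, ?_,
        fun j => isWalk_append.2 ⟨w, hP j, h2 j⟩, fun j => ?_, ?_⟩
      · simpa only [edgeLabel, List.flatMap_cons, List.nil_append] using h1
      · refine ((h3 j).append_left (P j)).trans ?_
        rw [← List.append_assoc, ← List.append_assoc]
        exact List.perm_append_comm.append_right _
      · simp only [edgeCost, List.map_cons, List.sum_cons, List.map_append, List.sum_append,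
          Finset.sum_add_distrib] at *
        rw [h4]; omega

/-- Conversely, a first-stage solution with recourse actions gives a walk of at most the same cost
in the auxiliary graph. Its arcs must occur in the same order in the paths of all scenarios. -/
theorem auxiliary_complete (hK : 0 < K) {φ : Fin G.n → ℝ} (hφ : G.IsPotential φ) {u v : Fin G.n}
    (hu : (u : ℕ) ∈ G.terminalNodes) (hv : (v : ℕ) ∈ G.terminalNodes)
    {l : List (Fin G.m)} {L : Fin K → List (Fin G.m)} (hL : ∀ j, G.IsWalk u (L j) v)
    (hl : ∀ j, l.Sublist (L j)) :
    ∃ W, IsEdgeWalk (List.ofFn (G.firstEdge f) ++ recourseEdges (G.intInst f g)) u W v ∧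
      W.length = 2 * l.length + 1 ∧
      edgeCost W + ∑ j, (l.map (g j)).sum ≤ (l.map f).sum + ∑ j, ((L j).map (g j)).sum := by
  induction l generalizing u L with
  | nil =>
    obtain ⟨c, hc, h⟩ := recourseEdges_complete (f := f) (g := g) hK hφ hu hv hL
    exact ⟨[(↑u, ↑v, c, [])], ⟨List.mem_append_right _ h, rfl, rfl⟩, rfl, by simpa [edgeCost]⟩
  | cons a l ih =>
    have h : ∀ j, ∃ P Q, L j = P ++ a :: Q ∧ l.Sublist Q := fun j => by
      obtain ⟨r₁, r₂, h1, h2, h3⟩ := List.cons_sublist_iff.1 (hl j)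
      obtain ⟨P, Q, rfl⟩ := List.append_of_mem h2
      exact ⟨P, Q ++ r₂, by simp [h1], h3.trans (List.sublist_append_right _ _)⟩
    choose P Q hPQ hQ using h
    have h2 : ∀ j, G.IsWalk u (P j) (G.tail a) ∧ G.IsWalk (G.head a) (Q j) v := fun j => by
      have := hL j
      rw [hPQ] at this
      obtain ⟨z, h3, rfl, h4⟩ := isWalk_append.1 this
      exact ⟨h3, h4⟩
    have ha : (G.tail a : ℕ) ∈ G.terminalNodes := by simp [terminalNodes]
    have ha' : (G.head a : ℕ) ∈ G.terminalNodes := by simp [terminalNodes]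
    obtain ⟨c, hc, h⟩ := recourseEdges_complete (f := f) (g := g) hK hφ hu ha fun j => (h2 j).1
    obtain ⟨W, hW, hlen, hcost⟩ := ih ha' (fun j => (h2 j).2) hQ
    refine ⟨(↑u, ↑(G.tail a), c, []) :: G.firstEdge f a :: W, ⟨List.mem_append_right _ h, rfl,
      List.mem_append_left _ (List.mem_ofFn.2 ⟨a, rfl⟩), rfl, hW⟩, by simp [hlen]; omega, ?_⟩
    simp only [edgeCost, hPQ, List.map_cons, List.sum_cons, List.map_append, List.sum_append,
      Finset.sum_add_distrib, firstEdge] at *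
    omega

theorem solveInt_sound {φ : Fin G.n → ℝ} (hφ : G.IsPotential φ) {b : Entry}
    (h : b ∈ solveInt (G.intInst f g)) :
    ∃ (l : List (Fin G.m)) (L y : Fin K → List (Fin G.m)), b.2.2 = l.map Fin.val ∧
      (∀ j, G.IsWalk G.s (L j) G.t) ∧ (∀ j, (L j).Perm (l ++ y j)) ∧
      b.2.1 = (l.map f).sum + ∑ j, ((y j).map (g j)).sum := by
  obtain ⟨h1, h2⟩ := mem_best h
  obtain ⟨W, hW, hc, hl⟩ := bellmanFord_sound h1
  obtain ⟨z, l, L, y, h3, h4, h5, h6, h7⟩ := auxiliary_sound hφ hW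
  obtain rfl : G.t = z := Fin.ext (h2.symm.trans h3)
  exact ⟨l, L, y, hl ▸ h4, h5, h6, hc ▸ h7⟩

theorem solveInt_complete (hK : 0 < K) {φ : Fin G.n → ℝ} (hφ : G.IsPotential φ)
    {l : List (Fin G.m)} {L : Fin K → List (Fin G.m)} (hL : ∀ j, G.IsWalk G.s (L j) G.t)
    (hl : ∀ j, l.Sublist (L j)) :
    ∃ b ∈ solveInt (G.intInst f g),
      b.2.1 + ∑ j, (l.map (g j)).sum ≤ (l.map f).sum + ∑ j, ((L j).map (g j)).sum := by
  obtain ⟨W, hW, hlen, hc⟩ := auxiliary_complete (f := f) (g := g) hK hφ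
    (by simp [terminalNodes]) (by simp [terminalNodes]) hL hl
  have h1 := (hl ⟨0, hK⟩).length_le.trans (hφ.length_le (hL ⟨0, hK⟩))
  obtain ⟨b, hb, hbt, hbc⟩ := bellmanFord_complete
    (R := (0, 0) :: ((G.intInst f g).2.2.1 ++ (G.intInst f g).2.2.1)) hW
    (by simp [intInst]; omega)
  obtain ⟨b', hb', hbc'⟩ := exists_mem_best_le hb hbt
  exact ⟨b', hb', by omega⟩

end Network

end TwoStage

namespace TwoStage

/-! ### Conditional value at risk and expectation -/

section CVaR

variable {K : ℕ} {α π : ℝ} {p Y : Fin K → ℝ}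

theorem expectation_le_of_level (h0 : 0 ≤ α) (h1 : α < 1) (hp : ∀ j, 0 ≤ p j)
    (hsum : ∑ j, p j = 1) (γ : ℝ) :
    ∑ j, p j * Y j ≤ γ + 1 / (1 - α) * ∑ j, p j * max (Y j - γ) 0 := by
  have h2 : ∑ j, p j * (Y j - γ) ≤ ∑ j, p j * max (Y j - γ) 0 :=
    Finset.sum_le_sum fun j _ => mul_le_mul_of_nonneg_left (le_max_left _ _) (hp j)
  have h3 : ∑ j, p j * (Y j - γ) = ∑ j, p j * Y j - γ := by
    simp_rw [mul_sub, Finset.sum_sub_distrib, ← Finset.sum_mul, hsum, one_mul]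
  have h4 : 0 ≤ ∑ j, p j * max (Y j - γ) 0 :=
    Finset.sum_nonneg fun j _ => mul_nonneg (hp j) (le_max_right _ _)
  have h5 : 1 ≤ 1 / (1 - α) := (one_le_div (by linarith)).2 (by linarith)
  nlinarith

theorem expectation_le_cvar (h0 : 0 ≤ α) (h1 : α < 1) (hp : ∀ j, 0 ≤ p j)
    (hsum : ∑ j, p j = 1) : ∑ j, p j * Y j ≤ cvar α p Y :=
  le_ciInf (expectation_le_of_level h0 h1 hp hsum)

theorem cvar_le_level (h0 : 0 ≤ α) (h1 : α < 1) (hp : ∀ j, 0 ≤ p j)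
    (hsum : ∑ j, p j = 1) (γ : ℝ) :
    cvar α p Y ≤ γ + 1 / (1 - α) * ∑ j, p j * max (Y j - γ) 0 :=
  ciInf_le ⟨_, Set.forall_mem_range.2 (expectation_le_of_level h0 h1 hp hsum)⟩ γ

/-- The level `0` gives the bound `1 / (1 - α)`, and a level above all values of positive
probability gives the bound `1 / π`. -/
theorem cvar_le_mul_expectation (h0 : 0 ≤ α) (h1 : α < 1) (hp : ∀ j, 0 ≤ p j)
    (hsum : ∑ j, p j = 1) (hY : ∀ j, 0 ≤ Y j) (hπ : 0 < π) (hπp : ∀ j, 0 < p j → π ≤ p j) :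
    cvar α p Y ≤ min (1 / π) (1 / (1 - α)) * ∑ j, p j * Y j := by
  have hE : 0 ≤ ∑ j, p j * Y j := Finset.sum_nonneg fun j _ => mul_nonneg (hp j) (hY j)
  rcases min_choice (1 / π) (1 / (1 - α)) with h | h <;> rw [h]
  · refine (cvar_le_level h0 h1 hp hsum (1 / π * ∑ j, p j * Y j)).trans_eq ?_
    refine (add_eq_left.2 ?_).trans rfl
    rw [Finset.sum_eq_zero fun j _ => ?_, mul_zero]
    rcases (hp j).eq_or_lt with hj | hj
    · rw [← hj, zero_mul]
    · have h2 : p j * Y j ≤ ∑ j, p j * Y j :=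
        Finset.single_le_sum (f := fun j => p j * Y j)
          (fun i _ => mul_nonneg (hp i) (hY i)) (Finset.mem_univ j)
      have h3 : Y j ≤ 1 / π * ∑ j, p j * Y j := by
        rw [one_div, ← div_eq_inv_mul, le_div_iff₀ hπ]
        nlinarith [hπp j hj, hY j]
      rw [max_eq_right (by linarith), mul_zero]
  · refine (cvar_le_level h0 h1 hp hsum 0).trans_eq ?_
    simp [hY]

theorem Costs.sum_p_real {m : ℕ} (D : Costs m) : ∑ j, (D.p j : ℝ) = 1 := by
  exact_mod_cast congrArg (fun q : NNRat => (q : ℝ)) D.sum_p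

theorem Costs.K_pos {m : ℕ} (D : Costs m) : 0 < D.K := by
  rcases Nat.eq_zero_or_pos D.K with h | h
  · have := D.sum_p
    have he : IsEmpty (Fin D.K) := by rw [h]; infer_instance
    simp at this
  · exact h

theorem Costs.prMin_pos {m : ℕ} (D : Costs m) : 0 < D.prMin := by
  have h : ∃ j, 0 < D.p j := by
    by_contra! h
    have := D.sum_p
    rw [Finset.sum_eq_zero fun j _ => le_antisymm (h j) zero_le] at this
    exact zero_ne_one this
  obtain ⟨j, hj⟩ := h
  have : Nonempty {j : Fin D.K // 0 < D.p j} := ⟨⟨j, hj⟩⟩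
  obtain ⟨i, hi⟩ := exists_eq_ciInf_of_finite
    (f := fun j : {j : Fin D.K // 0 < D.p j} => (D.p j : ℝ))
  rw [Costs.prMin, ← hi]
  exact_mod_cast i.2

theorem Costs.prMin_le {m : ℕ} (D : Costs m) (j : Fin D.K) (hj : 0 < D.p j) :
    D.prMin ≤ D.p j :=
  ciInf_le (f := fun j : {j : Fin D.K // 0 < D.p j} => (D.p j : ℝ))
    (Set.finite_range _).bddBelow ⟨j, hj⟩

end CVaR

/-! ### Series-parallel networks -/

namespace Network

variable {G : Network}

theorem mem_nodes_tail {E : Finset (Fin G.m)} {a : Fin G.m} (h : a ∈ E) : G.tail a ∈ G.nodes E :=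
  ⟨a, h, .inl rfl⟩

theorem mem_nodes_head {E : Finset (Fin G.m)} {a : Fin G.m} (h : a ∈ E) : G.head a ∈ G.nodes E :=
  ⟨a, h, .inr rfl⟩

theorem nodes_mono {E F : Finset (Fin G.m)} (h : E ⊆ F) : G.nodes E ⊆ G.nodes F :=
  fun _ ⟨a, ha, hv⟩ => ⟨a, h ha, hv⟩

theorem SP.terminal_mem {E : Finset (Fin G.m)} {u w : Fin G.n} (h : G.SP E u w) :
    u ∈ G.nodes E ∧ w ∈ G.nodes E := by
  induction h with
  | arc a _ => exact ⟨mem_nodes_tail (by simp), mem_nodes_head (by simp)⟩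
  | series _ _ _ h1 h2 =>
    exact ⟨nodes_mono Finset.subset_union_left h1.1, nodes_mono Finset.subset_union_right h2.2⟩
  | parallel _ _ _ _ h1 _ =>
    exact ⟨nodes_mono Finset.subset_union_left h1.1, nodes_mono Finset.subset_union_left h1.2⟩

theorem SP.exists_isWalk {E : Finset (Fin G.m)} {u w : Fin G.n} (h : G.SP E u w) :
    ∃ L, G.IsWalk u L w := by
  induction h with
  | arc a _ => exact ⟨[a], rfl, rfl⟩
  | series _ _ _ h1 h2 =>
    obtain ⟨L, hL⟩ := h1
    obtain ⟨L', hL'⟩ := h2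
    exact ⟨L ++ L', isWalk_append.2 ⟨_, hL, hL'⟩⟩
  | parallel _ _ _ _ h1 _ => exact h1

/-- Two potentials which agree on the common nodes can be glued. -/
theorem exists_glue {E F : Finset (Fin G.m)} {φ ψ : Fin G.n → ℝ}
    (hφ : ∀ a ∈ E, φ (G.tail a) < φ (G.head a)) (hψ : ∀ a ∈ F, ψ (G.tail a) < ψ (G.head a))
    (h : ∀ v ∈ G.nodes E ∩ G.nodes F, φ v = ψ v) :
    ∃ χ : Fin G.n → ℝ, (∀ v ∈ G.nodes E, χ v = φ v) ∧ (∀ v ∈ G.nodes F, χ v = ψ v) ∧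
      ∀ a ∈ E ∪ F, χ (G.tail a) < χ (G.head a) := by
  classical
  let χ : Fin G.n → ℝ := fun v => if v ∈ G.nodes E then φ v else ψ v
  have h1 : ∀ v ∈ G.nodes E, χ v = φ v := fun v hv => if_pos hv
  have h2 : ∀ v ∈ G.nodes F, χ v = ψ v := fun v hv => by
    by_cases hE : v ∈ G.nodes E
    · rw [h1 v hE, h v ⟨hE, hv⟩]
    · exact if_neg hE
  refine ⟨χ, h1, h2, fun a ha => ?_⟩
  rcases Finset.mem_union.1 ha with ha | ha
  · rw [h1 _ (mem_nodes_tail ha), h1 _ (mem_nodes_head ha)]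
    exact hφ a ha
  · rw [h2 _ (mem_nodes_tail ha), h2 _ (mem_nodes_head ha)]
    exact hψ a ha

/-- Series-parallel graphs are acyclic. The potentials are normalized to the values `0` and `1` at
the terminals, so that those of the two parts of a parallel composition fit together. -/
theorem SP.exists_potential {E : Finset (Fin G.m)} {u w : Fin G.n} (h : G.SP E u w) :
    ∃ φ : Fin G.n → ℝ, φ u = 0 ∧ φ w = 1 ∧ ∀ a ∈ E, φ (G.tail a) < φ (G.head a) := by
  induction h with
  | arc a h =>
    exact ⟨fun v => if v = G.head a then 1 else 0, if_neg h, if_pos rfl, by simp [h]⟩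
  | series hE hF hv h1 h2 =>
    obtain ⟨φ, hφ0, hφ1, hφ⟩ := h1
    obtain ⟨ψ, hψ0, hψ1, hψ⟩ := h2
    obtain ⟨χ, h3, h4, h5⟩ := exists_glue (φ := fun v => φ v / 2) (ψ := fun v => (1 + ψ v) / 2)
      (fun a ha => by have := hφ a ha; linarith)
      (fun a ha => by have := hψ a ha; linarith)
      (fun x hx => by rw [hv] at hx; rw [Set.mem_singleton_iff.1 hx, hφ1, hψ0]; norm_num)
    exact ⟨χ, by rw [h3 _ hE.terminal_mem.1, hφ0, zero_div],
      by rw [h4 _ hF.terminal_mem.2, hψ1]; norm_num, h5⟩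
  | parallel hE hF _ hv h1 h2 =>
    obtain ⟨φ, hφ0, hφ1, hφ⟩ := h1
    obtain ⟨ψ, hψ0, hψ1, hψ⟩ := h2
    obtain ⟨χ, h3, h4, h5⟩ := exists_glue hφ hψ fun x hx => by
      rw [hv] at hx
      rcases hx with rfl | rfl
      · rw [hφ0, hψ0]
      · rw [hφ1, hψ1]
    exact ⟨χ, by rw [h3 _ hE.terminal_mem.1, hφ0], by rw [h3 _ hE.terminal_mem.2, hφ1], h5⟩

theorem IsSeriesParallel.exists_potential (h : G.IsSeriesParallel) :
    ∃ φ : Fin G.n → ℝ, G.IsPotential φ :=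
  let ⟨φ, _, _, hφ⟩ := h.1.exists_potential
  ⟨φ, fun a => hφ a (Finset.mem_univ a)⟩

end Network

/-! ### Solutions as vectors -/

section Vectors

variable {m : ℕ}

theorem linCost_count (c : Fin m → NNRat) (l : List (Fin m)) :
    linCost c (fun a => l.count a) = (l.map fun a => (c a : ℝ)).sum := by
  induction l with
  | nil => simp [linCost]
  | cons b l ih =>
    rw [List.map_cons, List.sum_cons, ← ih]
    simp only [linCost, List.count_cons, Nat.cast_add, mul_add, Finset.sum_add_distrib]
    rw [add_comm]
    congr 1
    simp

theorem linCost_add (c : Fin m → NNRat) (x y : Fin m → ℕ) :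
    linCost c (x + y) = linCost c x + linCost c y := by
  simp [linCost, mul_add, Finset.sum_add_distrib]

theorem linCost_nonneg (c : Fin m → NNRat) (x : Fin m → ℕ) : 0 ≤ linCost c x :=
  Finset.sum_nonneg fun a _ => by positivity

theorem recourseCost_nonneg (X : Set (Fin m → ℕ)) (x : Fin m → ℕ) (c : Fin m → NNRat) :
    0 ≤ recourseCost X x c :=
  Real.sInf_nonneg (by rintro _ ⟨y, _, rfl⟩; exact linCost_nonneg c y)

theorem recourseCost_le {X : Set (Fin m → ℕ)} {x y : Fin m → ℕ} (c : Fin m → NNRat)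
    (h : y ∈ recourse X x) : recourseCost X x c ≤ linCost c y :=
  csInf_le ⟨0, by rintro _ ⟨y, _, rfl⟩; exact linCost_nonneg c y⟩ ⟨y, h, rfl⟩

theorem recourse_finite (X : Set (Fin m → ℕ)) (x : Fin m → ℕ) : (recourse X x).Finite := by
  refine (Set.Finite.pi' fun _ => (Set.finite_Iic 1)).subset fun y hy a => ?_
  rcases hy.1 a with h | h <;> simp [h]

theorem exists_recourseCost_eq {X : Set (Fin m → ℕ)} {x : Fin m → ℕ} (c : Fin m → NNRat)
    (h : (recourse X x).Nonempty) : ∃ y ∈ recourse X x, linCost c y = recourseCost X x c :=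
  (h.image (linCost c)).csInf_mem ((recourse_finite X x).image _)

/-- The expected cost of a first-stage solution. -/
noncomputable def Costs.expectedCost (D : Costs m) (X : Set (Fin m → ℕ)) (x : Fin m → ℕ) : ℝ :=
  ∑ j, (D.p j : ℝ) * (linCost D.C x + recourseCost X x (D.c j))

/-- A solution of minimum expected cost is a good solution for every level of the CVaR. -/
theorem Costs.cvarCost_le (D : Costs m) {X : Set (Fin m → ℕ)} {α : ℝ} (h0 : 0 ≤ α) (h1 : α < 1)
    {x : Fin m → ℕ} (hx : x ∈ partialSolutions X)
    (hopt : ∀ x' ∈ partialSolutions X, D.expectedCost X x ≤ D.expectedCost X x') :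
    D.cvarCost X α x ≤
      min (1 / D.prMin) (1 / (1 - α)) * sInf (D.cvarCost X α '' partialSolutions X) := by
  have hp : ∀ j, 0 ≤ (D.p j : ℝ) := fun j => by positivity
  have hρ : 0 < min (1 / D.prMin) (1 / (1 - α)) :=
    lt_min (one_div_pos.2 D.prMin_pos) (one_div_pos.2 (by linarith))
  rw [mul_comm, ← div_le_iff₀ hρ]
  refine le_csInf (Set.Nonempty.image _ ⟨x, hx⟩) ?_
  rintro _ ⟨x', hx', rfl⟩
  rw [div_le_iff₀ hρ, mul_comm]
  have h2 := cvar_le_mul_expectation (Y := fun j => linCost D.C x + recourseCost X x (D.c j))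
    h0 h1 hp D.sum_p_real (fun j => add_nonneg (linCost_nonneg _ _) (recourseCost_nonneg _ _ _))
    D.prMin_pos fun j hj => D.prMin_le j (by exact_mod_cast hj)
  refine h2.trans (mul_le_mul_of_nonneg_left ((hopt x' hx').trans ?_) hρ.le)
  exact expectation_le_cvar h0 h1 hp D.sum_p_real

end Vectors

/-! ### Optimality of the computed solution -/

namespace Network

variable {G : Network}

theorem count_mem_pathVectors {φ : Fin G.n → ℝ} (hφ : G.IsPotential φ) {L : List (Fin G.m)}
    (h : G.IsWalk G.s L G.t) : (fun a => L.count a) ∈ G.pathVectors :=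
  ⟨L, hφ.isSimplePath h, fun a => by
    split_ifs with ha
    · exact List.count_eq_one_of_mem (hφ.nodup h) ha
    · exact List.count_eq_zero_of_not_mem ha⟩

/-- A list of arcs which extends to a path describes a binary vector. -/
theorem isBinary_count {φ : Fin G.n → ℝ} (hφ : G.IsPotential φ) {u v : Fin G.n}
    {L l : List (Fin G.m)} (h : G.IsWalk u L v) (hl : ∀ a, l.count a ≤ L.count a) :
    IsBinary fun a => l.count a := fun a => by
  have h1 := List.nodup_iff_count_le_one.1 (hφ.nodup h) a
  have h2 := hl a
  change l.count a = 0 ∨ l.count a = 1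
  omega

theorem count_mem_recourse {φ : Fin G.n → ℝ} (hφ : G.IsPotential φ) {L l y : List (Fin G.m)}
    (h : G.IsWalk G.s L G.t) (hp : L.Perm (l ++ y)) :
    (fun a => y.count a) ∈ recourse G.pathVectors fun a => l.count a := by
  have h1 : ∀ a, L.count a = l.count a + y.count a := fun a => by
    rw [hp.count_eq, List.count_append]
  refine ⟨isBinary_count hφ h fun a => by have := h1 a; omega, ?_⟩
  convert count_mem_pathVectors hφ h using 1
  funext a
  exact (h1 a).symm

theorem count_mem_partialSolutions {φ : Fin G.n → ℝ} (hφ : G.IsPotential φ)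
    {L l y : List (Fin G.m)} (h : G.IsWalk G.s L G.t) (hp : L.Perm (l ++ y)) :
    (fun a => l.count a) ∈ partialSolutions G.pathVectors := by
  refine ⟨isBinary_count hφ h fun a => ?_, _, count_mem_recourse hφ h hp⟩
  rw [hp.count_eq, List.count_append]
  omega

/-- The arcs of a first-stage solution occur in the same order in all paths which contain it. -/
theorem exists_common_sublist {φ : Fin G.n → ℝ} (hφ : G.IsPotential φ) {K : ℕ} (hK : 0 < K)
    {x : Fin G.m → ℕ} (hx : IsBinary x) {y : Fin K → Fin G.m → ℕ} {L : Fin K → List (Fin G.m)}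
    (hL : ∀ j, G.IsWalk G.s (L j) G.t)
    (hy : ∀ j a, (x + y j) a = if a ∈ L j then 1 else 0) :
    ∃ l : List (Fin G.m), (∀ j, l.Sublist (L j)) ∧ x = fun a => l.count a := by
  -- Along a path the potential of the heads increases, so the potential determines the order.
  let l : Fin K → List (Fin G.m) := fun j => (L j).filter fun a => x a = 1
  have hmem : ∀ j a, a ∈ l j ↔ x a = 1 := fun j a => by
    simp only [l, List.mem_filter, decide_eq_true_eq, and_iff_right_iff_imp]
    intro ha
    by_contra hn
    have := hy j a
    rw [if_neg hn, Pi.add_apply] at this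
    omega
  have hnodup : ∀ j, (l j).Nodup := fun j => (hφ.nodup (hL j)).filter _
  have hpw : ∀ j, (l j).Pairwise fun a b => φ (G.head a) < φ (G.head b) := fun j =>
    (hφ.pairwise_head (hL j)).filter _
  have heq : ∀ j, l ⟨0, hK⟩ = l j := fun j =>
    List.Perm.eq_of_pairwise (fun a b _ _ h1 h2 => absurd (h1.trans h2) (lt_irrefl _))
      (hpw _) (hpw j) ((List.perm_ext_iff_of_nodup (hnodup _) (hnodup j)).2 fun a => by
        rw [hmem, hmem])
  refine ⟨l ⟨0, hK⟩, fun j => heq j ▸ List.filter_sublist, funext fun a => ?_⟩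
  rcases hx a with h | h
  · rw [h, List.count_eq_zero_of_not_mem]
    rw [hmem]; omega
  · rw [h, List.count_eq_one_of_mem (hnodup _) ((hmem _ a).2 h)]

/-- The real cost of an integral solution, up to the scaling factor `M`. -/
theorem cast_sum_map {f : Fin G.m → ℕ} {c : Fin G.m → NNRat} {M : ℝ}
    (hf : ∀ a, (f a : ℝ) = M * (c a : ℝ)) (l : List (Fin G.m)) :
    (((l.map f).sum : ℕ) : ℝ) = M * linCost c fun a => l.count a := by
  rw [linCost_count]
  induction l with
  | nil => simp
  | cons a l ih => simp [ih, hf, mul_add]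

/-- The algorithm computes a first-stage solution of minimum expected cost. -/
theorem solveInt_optimal (hsp : G.IsSeriesParallel) (D : Costs G.m) {f : Fin G.m → ℕ}
    {g : Fin D.K → Fin G.m → ℕ} {M : ℝ} (hM : 0 < M) (hf : ∀ a, (f a : ℝ) = M * D.C a)
    (hg : ∀ j a, (g j a : ℝ) = (M * D.p j) * D.c j a) :
    ∃ (b : Entry) (l : List (Fin G.m)), solveInt (G.intInst f g) = [b] ∧ b.2.2 = l.map Fin.val ∧
      (fun a => l.count a) ∈ partialSolutions G.pathVectors ∧
      ∀ x ∈ partialSolutions G.pathVectors,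
        D.expectedCost G.pathVectors (fun a => l.count a) ≤ D.expectedCost G.pathVectors x := by
  obtain ⟨φ, hφ⟩ := hsp.exists_potential
  obtain ⟨L₀, hL₀⟩ := hsp.1.exists_isWalk
  obtain ⟨b, hb, -⟩ := solveInt_complete (f := f) (g := g) D.K_pos hφ (fun _ => hL₀)
    (fun _ => List.nil_sublist _)
  obtain ⟨b', hb'⟩ := List.length_eq_one_iff.1 (le_antisymm (best_length_le _ _)
    (List.length_pos_of_mem hb))
  obtain rfl : b = b' := List.mem_singleton.1 (hb' ▸ hb)
  obtain ⟨l, L, y, hl, hL, hperm, hcost⟩ := solveInt_sound hφ hb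
  refine ⟨b, l, hb', hl, count_mem_partialSolutions hφ (hL ⟨0, D.K_pos⟩)
    (hperm ⟨0, D.K_pos⟩), fun x hx => ?_⟩
  have hexp : ∀ z (r : Fin D.K → ℝ), M * ∑ j, (D.p j : ℝ) * (linCost D.C z + r j) =
      M * linCost D.C z + ∑ j, M * D.p j * r j := fun z r => by
    simp_rw [mul_add, Finset.sum_add_distrib, ← Finset.sum_mul, D.sum_p_real, one_mul, mul_add,
      Finset.mul_sum, mul_assoc]
  -- The computed cost is at least the expected cost of the computed solution.
  have hupper : M * D.expectedCost G.pathVectors (fun a => l.count a) ≤ b.2.1 := by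
    rw [Costs.expectedCost, hexp, hcost, Nat.cast_add, Nat.cast_sum, cast_sum_map hf]
    gcongr with j
    rw [cast_sum_map (hg j)]
    gcongr
    exact recourseCost_le _ (count_mem_recourse hφ (hL j) (hperm j))
  -- The computed cost is at most the expected cost of every other solution.
  have hlower : (b.2.1 : ℝ) ≤ M * D.expectedCost G.pathVectors x := by
    choose z hz hzc using fun j => exists_recourseCost_eq (D.c j) hx.2
    choose P hP hPz using fun j => (hz j).2
    obtain ⟨k, hk, rfl⟩ := exists_common_sublist hφ D.K_pos hx.1 (fun j => (hP j).1) hPz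
    obtain ⟨b'', hb'', hle⟩ := solveInt_complete (f := f) (g := g) D.K_pos hφ
      (fun j => (hP j).1) hk
    obtain rfl : b'' = b := List.mem_singleton.1 (hb' ▸ hb'')
    have hsum : ∀ j, (((P j).map (g j)).sum : ℝ) =
        ((k.map (g j)).sum : ℝ) + M * D.p j * linCost (D.c j) (z j) := fun j => by
      rw [cast_sum_map (hg j), cast_sum_map (hg j), ← mul_add, ← linCost_add]
      congr 2
      funext a
      rw [hPz j a]
      split_ifs with ha
      · exact List.count_eq_one_of_mem (hφ.nodup (hP j).1) ha
      · exact List.count_eq_zero_of_not_mem ha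
    rw [Costs.expectedCost, hexp]
    have hle' : (b''.2.1 : ℝ) + ∑ j, ((k.map (g j)).sum : ℝ) ≤
        (k.map f).sum + ∑ j, (((P j).map (g j)).sum : ℝ) := by exact_mod_cast hle
    simp_rw [hsum, Finset.sum_add_distrib, cast_sum_map hf] at hle'
    simp_rw [← hzc]
    linarith
  exact le_of_mul_le_mul_left (hupper.trans hlower) hM

end Network

/-! ### Scaling to integral costs -/

/-- A nonnegative rational as a pair of numbers. -/
def ratPair (q : NNRat) : ℕ × ℕ := (q.num, q.den)

/-- The data of an instance. -/
def SPInstance.raw (I : SPInstance) : RawInst :=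
  (I.G.n, I.G.s, I.G.t, List.ofFn fun a => ((I.G.tail a : ℕ), (I.G.head a : ℕ)),
    List.ofFn fun a => ratPair (I.D.C a), List.ofFn fun j => List.ofFn fun a => ratPair (I.D.c j a),
    List.ofFn fun j => ratPair (I.D.p j), ())

theorem SPInstance.enc_raw (I : SPInstance) : Enc.enc I.raw = I.encode := by
  simp [SPInstance.raw, SPInstance.encode, Enc.enc, encodeFn, encodeList, encodeRat, ratPair,
    List.map_ofFn, Function.comp_def]

theorem zip_ofFn {β γ : Type} {k : ℕ} (f : Fin k → β) (g : Fin k → γ) :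
    (List.ofFn f).zip (List.ofFn g) = List.ofFn fun i => (f i, g i) := by
  apply List.ext_getElem <;> simp

theorem zipIdx_ofFn {β : Type} {k : ℕ} (f : Fin k → β) :
    (List.ofFn f).zipIdx = List.ofFn fun i => (f i, (i : ℕ)) := by
  apply List.ext_getElem <;> simp

theorem dvd_denProd {q : ℕ × ℕ} {l : List (ℕ × ℕ)} (h : q ∈ l) : q.2 ∣ denProd l :=
  List.dvd_prod (List.mem_map_of_mem h)

theorem denProd_pos {l : List (ℕ × ℕ)} (h : ∀ q ∈ l, 0 < q.2) : 0 < denProd l :=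
  List.prod_pos fun d hd => by
    obtain ⟨q, hq, rfl⟩ := List.mem_map.1 hd
    exact h q hq

theorem cast_expand {M : ℕ} {q : NNRat} (h : q.den ∣ M) :
    (expand M (ratPair q) : ℝ) = M * (q : ℝ) := by
  obtain ⟨d, rfl⟩ := h
  have h1 : (q.den : ℝ) ≠ 0 := by exact_mod_cast q.den_pos.ne'
  have h2 : (q : ℝ) = q.num / q.den := by
    conv_lhs => rw [← NNRat.num_div_den q]
    push_cast; rfl
  rw [expand, ratPair, Nat.mul_div_cancel_left _ q.den_pos, h2]
  push_cast
  field_simp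

theorem SPInstance.commonDen_pos (I : SPInstance) : 0 < commonDen I.raw := by
  refine Nat.mul_pos (denProd_pos fun q hq => ?_)
    (Nat.mul_pos (denProd_pos fun q hq => ?_) (denProd_pos fun q hq => ?_))
  · obtain ⟨a, rfl⟩ := List.mem_ofFn.1 hq
    exact NNRat.den_pos _
  · obtain ⟨l, hl, hq⟩ := List.mem_flatten.1 hq
    obtain ⟨j, rfl⟩ := List.mem_ofFn.1 hl
    obtain ⟨a, rfl⟩ := List.mem_ofFn.1 hq
    exact NNRat.den_pos _
  · obtain ⟨a, rfl⟩ := List.mem_ofFn.1 hq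
    exact NNRat.den_pos _

theorem SPInstance.expand_C (I : SPInstance) (a : Fin I.G.m) :
    (expand (commonDen I.raw) (ratPair (I.D.C a)) : ℝ) = commonDen I.raw * I.D.C a :=
  cast_expand ((dvd_denProd (q := ratPair (I.D.C a)) (List.mem_ofFn.2 ⟨a, rfl⟩)).trans
    (Dvd.intro _ rfl))

theorem SPInstance.expand_c (I : SPInstance) (j : Fin I.D.K) (a : Fin I.G.m) :
    (expand (commonDen I.raw) (ratPair (I.D.c j a)) : ℝ) = commonDen I.raw * I.D.c j a :=
  cast_expand ((dvd_denProd (q := ratPair (I.D.c j a)) (List.mem_flatten.2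
    ⟨_, List.mem_ofFn.2 ⟨j, rfl⟩, List.mem_ofFn.2 ⟨a, rfl⟩⟩)).trans
      ((Dvd.intro _ rfl).trans (Dvd.intro_left _ rfl)))

theorem SPInstance.expand_p (I : SPInstance) (j : Fin I.D.K) :
    (expand (commonDen I.raw) (ratPair (I.D.p j)) : ℝ) = commonDen I.raw * I.D.p j :=
  cast_expand ((dvd_denProd (q := ratPair (I.D.p j)) (List.mem_ofFn.2 ⟨j, rfl⟩)).trans
    ((Dvd.intro_left _ rfl).trans (Dvd.intro_left _ rfl)))

/-- The scaled first-stage costs. -/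
def SPInstance.firstCost (I : SPInstance) (a : Fin I.G.m) : ℕ :=
  commonDen I.raw * expand (commonDen I.raw) (ratPair (I.D.C a))

/-- The scaled second-stage costs, multiplied by the probability of the scenario. -/
def SPInstance.secondCost (I : SPInstance) (j : Fin I.D.K) (a : Fin I.G.m) : ℕ :=
  expand (commonDen I.raw) (ratPair (I.D.p j)) * expand (commonDen I.raw) (ratPair (I.D.c j a))

theorem SPInstance.integerInst_raw (I : SPInstance) :
    integerInst I.raw = I.G.intInst I.firstCost I.secondCost := by
  generalize hM : commonDen I.raw = M
  simp only [integerInst, Network.intInst, hM]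
  simp only [SPInstance.raw, zipList_eq, positions_eq, zip_ofFn, zipIdx_ofFn, List.map_ofFn,
    Function.comp_def]
  subst hM
  rfl

theorem sum_map_ite_val_eq {m : ℕ} (l : List (Fin m)) (a : Fin m) :
    (l.map fun i : Fin m => if (i : ℕ) = a then 1 else 0).sum = l.count a := by
  induction l with
  | nil => rfl
  | cons i l ih => simp [List.count_cons, ih, Fin.ext_iff, add_comm]

/-- The algorithm outputs a first-stage solution of minimum expected cost. -/
theorem solve_optimal (I : SPInstance) :
    ∃ x ∈ partialSolutions I.G.pathVectors, solve I.raw = List.ofFn x ∧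
      ∀ x' ∈ partialSolutions I.G.pathVectors,
        I.D.expectedCost I.G.pathVectors x ≤ I.D.expectedCost I.G.pathVectors x' := by
  have hM : (0 : ℝ) < commonDen I.raw := by exact_mod_cast I.commonDen_pos
  obtain ⟨b, l, hb, hl, hx, hopt⟩ := Network.solveInt_optimal I.isSP I.D (f := I.firstCost)
    (g := I.secondCost) (M := commonDen I.raw * commonDen I.raw) (mul_pos hM hM)
    (fun a => by rw [SPInstance.firstCost, Nat.cast_mul, I.expand_C, mul_assoc])
    (fun j a => by rw [SPInstance.secondCost, Nat.cast_mul, I.expand_c, I.expand_p]; ring)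
  refine ⟨_, hx, ?_, hopt⟩
  rw [solve, I.integerInst_raw, hb]
  simp [hl, SPInstance.raw, positions_eq, zipIdx_ofFn, List.map_ofFn, Function.comp_def,
    sum_map_ite_val_eq]

end TwoStage

theorem mainTheorem7 :
    ∃ A : TwoStage.Prog, ∀ α : ℝ, 0 ≤ α → α < 1 →
      TwoStage.IsApproxAlgorithm A (TwoStage.cvarShortestPathSP α)
        (fun I : TwoStage.SPInstance => min (1 / I.D.prMin) (1 / (1 - α))) := by
  obtain ⟨A, q, hA⟩ := TwoStage.PolyTime.solve
  refine ⟨A, fun α h0 h1 => ⟨q, fun I => ?_⟩⟩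
  obtain ⟨x, hx, hsolve, hopt⟩ := TwoStage.solve_optimal I
  obtain ⟨k, hk, hkq⟩ := hA I.raw
  refine ⟨x, hx, k, ?_, ?_, I.D.cvarCost_le h0 h1 hx hopt⟩
  · have h : TwoStage.Enc.enc (List.ofFn x) = TwoStage.encodeFn fun a => .num (x a) := by
      simp [TwoStage.Enc.enc, TwoStage.encodeFn, List.map_ofFn, Function.comp_def]
    rw [I.enc_raw, hsolve, h] at hk
    exact hk
  · rw [TwoStage.esize, I.enc_raw] at hkq
    exact hkq
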